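/- Conventions. An $\Omega$-spectrum is a family of pointed spaces $(F_n)_{n\in\mathbb Z}$ with pointed homotopy equivalences $F_n\simeq\Omega F_{n+1}$. It defines $h^n(X)=[X,F_n]$ (homotopy classes of maps) for a space $X$ and $\tilde h^n(X)=\langle X,F_n\rangle$ (pointed homotopy classes of pointed maps) for a pointed space $X$; these are abelian groups under pointwise concatenation of loops, via $F_n\simeq\Omega F_{n+1}$. A group $G$ means a Hausdorff space with a group structure whose inversion is continuous and whose multiplication is continuous for the compactly generated topology on $G\times G$ (for instance any Hausdorff topological group, in particular any CW-group); homomorphisms are continuous. $BG$ is the geometric realization of the bar construction of $G$, $BG=\coprod_n \Delta^n\times G^n/\!\sim$, where $G^n$ has the compactly generated product topology; it is pointed by its unique vertex and functorial in $G$. Let $s_0$ be the basepoint of $S^1=\mathbb R/\mathbb Z$, and let $B\mathbb Z\to S^1$ be the canonical map induced by the piecewise affine map $E\mathbb Z\to\mathbb R$ extending $\mathbb Z\subset\mathbb R$. Theorem. Let $(F_n)$ be an $\Omega$-spectrum and $d\in\mathbb Z$. For every group $G$ there is a commutative diagram of abelian groups $$\begin{array}{ccccccccc} 0&\to& h^{d-1}(BG)&\xrightarrow{\tilde\alpha}&\tilde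 h^d(B(\mathbb Z\times G))&\xrightarrow{\tilde\beta}&\tilde h^d(BG)&\to&0\\ &&\|&&\downarrow&&\downarrow&&\\ 0&\to& h^{d-1}(BG)&\xrightarrow{\alpha}&h^d(B(\mathbb Z\times G))&\xrightarrow{\beta}&h^d(BG)&\to&0 \end{array}$$ natural with respect to homomorphisms $G\to G'$. Here the two vertical arrows forget basepoints; $\tilde\beta$ and $\beta$ are induced by $G\hookrightarrow\mathbb Z\times G$, $g\mapsto(0,g)$; $\tilde\alpha$ is the composition $$h^{d-1}(BG)=[BG,F_{d-1}]\cong[BG,\Omega F_d]\cong\big\langle (S^1\times BG)/(\{s_0\}\times BG),F_d\big\rangle\to\langle S^1\times BG,F_d\rangle\to\langle B(\mathbb Z\times G),F_d\rangle=\tilde h^d(B(\mathbb Z\times G)),$$ the last arrow being induced by $B(\mathbb Z\times G)\to B\mathbb Z\times BG\to S^1\times BG$; and $\alpha$ is the unique map making the diagram commute. Both rows are short exact sequences, naturally split by the maps $\tilde\sigma:\tilde h^d(BG)\to\tilde h^d(B(\mathbb Z\times G))$ and $\sigma:h^d(BG)\to h^d(B(\mathbb Z\times G))$ induced by $\mathbb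 Z\times G\twoheadrightarrow G$, $(i,g)\mapsto g$, and these splittings are compatible with the vertical arrows. Consequently there are isomorphisms, natural in $G$, $$\tilde h^d(B(\mathbb Z\times G))\cong h^{d-1}(BG)\oplus\tilde h^d(BG),\qquad h^d(B(\mathbb Z\times G))\cong h^{d-1}(BG)\oplus h^d(BG),$$ whose inverses are $(a,b)\mapsto\tilde\alpha(a)+\tilde\sigma(b)$ and $(a,b)\mapsto\alpha(a)+\sigma(b)$, and whose projections to the second summand are $\tilde\beta$ and $\beta$. -/

import Mathlib

universe u v

noncomputable section

open scoped unitInterval CompactCoherentification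

namespace GenCoh

/-! ### Homotopy classes of maps of pairs -/

section PairClass

variable {X X' Y Z : Type*} [TopologicalSpace X] [TopologicalSpace X'] [TopologicalSpace Y]
  [TopologicalSpace Z]

/-- Continuous maps `X → Y` that send the subspace `A` to the basepoint `y`. -/
def PairMap (A : Set X) (y : Y) : Type _ := {f : C(X, Y) // ∀ a ∈ A, f a = y}

/-- Homotopy through maps sending `A` to the basepoint, i.e. homotopy relative to `A`. -/
instance PairMap.setoid (A : Set X) (y : Y) : Setoid (PairMap A y) where
  r f g := f.1.HomotopicRel g.1 A
  iseqv := ⟨fun f => .refl f.1, fun h => h.symm, fun h k => h.trans k⟩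

/-- Homotopy classes of maps of pairs `(X, A) → (Y, {y})`. For `A = ∅` this is the set `[X, Y]` of
free homotopy classes, for `A = {x₀}` it is the set `⟨X, Y⟩` of pointed homotopy classes, and in
general it is the set `⟨X/A, Y⟩` (with `X/∅ = X ⊔ pt`), because homotopies on a quotient space are
the same as homotopies that are compatible with the quotient map. -/
def PairClass (A : Set X) (y : Y) : Type _ := Quotient (PairMap.setoid A y)

/-- The class of a map of pairs. -/
def PairClass.mk {A : Set X} {y : Y} (f : PairMap A y) : PairClass A y := Quotient.mk _ f

theorem PairMap.rel_of {A : Set X} {y : Y} {f g : PairMap A y} (H : C(I × X, Y))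
    (h0 : ∀ x, H (0, x) = f.1 x) (h1 : ∀ x, H (1, x) = g.1 x)
    (hA : ∀ t, ∀ a ∈ A, H (t, a) = y) : f.1.HomotopicRel g.1 A :=
  ⟨{ toContinuousMap := H
     map_zero_left := h0
     map_one_left := h1
     prop' := fun t a ha => (hA t a ha).trans (f.2 a ha).symm }⟩

theorem PairClass.sound {A : Set X} {y : Y} {f g : PairMap A y} (H : C(I × X, Y))
    (h0 : ∀ x, H (0, x) = f.1 x) (h1 : ∀ x, H (1, x) = g.1 x)
    (hA : ∀ t, ∀ a ∈ A, H (t, a) = y) : PairClass.mk f = PairClass.mk g :=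
  Quotient.sound (PairMap.rel_of H h0 h1 hA)

/-- The map on homotopy classes induced by precomposition with a map of pairs. -/
def PairClass.pull {A : Set X} {A' : Set X'} {y : Y} (f : C(X, X')) (hf : Set.MapsTo f A A') :
    PairClass A' y → PairClass A y :=
  Quotient.map' (fun c => ⟨c.1.comp f, fun a ha => c.2 _ (hf ha)⟩) (by
    rintro c c' ⟨H⟩
    refine PairMap.rel_of (H.toContinuousMap.comp ((ContinuousMap.id I).prodMap f)) ?_ ?_ ?_
    · intro x; exact H.apply_zero _
    · intro x; exact H.apply_one _
    · intro t a ha; exact (H.eq_fst t (hf ha)).trans (c.2 _ (hf ha)))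

/-- The map on homotopy classes induced by postcomposition with a pointed map. -/
def PairClass.push {A : Set X} {y : Y} {z : Z} (φ : C(Y, Z)) (hφ : φ y = z) :
    PairClass A y → PairClass A z :=
  Quotient.map' (fun c => ⟨φ.comp c.1, fun a ha => (congrArg φ (c.2 a ha)).trans hφ⟩) (by
    rintro c c' ⟨H⟩
    refine PairMap.rel_of (φ.comp H.toContinuousMap) ?_ ?_ ?_
    · intro x; exact congrArg φ (H.apply_zero _)
    · intro x; exact congrArg φ (H.apply_one _)
    · intro t a ha
      exact (congrArg φ ((H.eq_fst t ha).trans (c.2 _ ha))).trans hφ)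

theorem PairClass.push_push_of_homotopic {A : Set X} {y : Y} {z : Z} {φ : C(Y, Z)} {ψ : C(Z, Y)}
    (hφ : φ y = z) (hψ : ψ z = y) (h : (ψ.comp φ).HomotopicRel (ContinuousMap.id Y) {y})
    (c : PairClass A y) : push ψ hψ (push φ hφ c) = c := by
  obtain ⟨H⟩ := h
  induction c using Quotient.inductionOn with | _ c =>
  refine PairClass.sound (H.toContinuousMap.comp ((ContinuousMap.id I).prodMap c.1)) ?_ ?_ ?_
  · intro x; exact H.apply_zero _
  · intro x; exact H.apply_one _
  · intro t a ha
    have : c.1 a = y := c.2 a ha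
    change H (t, c.1 a) = y
    rw [this]
    exact H.eq_snd t rfl

end PairClass

/-! ### Loop spaces

The loop space of `(Y, y)` is the space `Path y y` of loops `[0, 1] → Y` at `y` with the
compact-open topology, pointed by the constant loop `Path.refl y`. -/

section Loops

variable {X X' Y Z : Type*} [TopologicalSpace X] [TopologicalSpace X'] [TopologicalSpace Y]
  [TopologicalSpace Z]

/-- Pointwise concatenation of two families of loops. -/
def PairMap.concat {A : Set X} {y : Y} (f g : PairMap A (Path.refl y)) :
    PairMap A (Path.refl y) :=
  ⟨⟨fun x => (f.1 x).trans (g.1 x), f.1.continuous.path_trans g.1.continuous⟩, fun a ha => by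
    change (f.1 a).trans (g.1 a) = _
    rw [f.2 a ha, g.2 a ha, Path.refl_trans_refl]⟩

/-- Pointwise reversal of a family of loops. -/
def PairMap.reverse {A : Set X} {y : Y} (f : PairMap A (Path.refl y)) : PairMap A (Path.refl y) :=
  ⟨⟨fun x => (f.1 x).symm, Path.continuous_symm.comp f.1.continuous⟩, fun a ha => by
    change (f.1 a).symm = _
    rw [f.2 a ha, Path.refl_symm]⟩

/-- The family of constant loops. -/
def PairMap.const (A : Set X) (y : Y) : PairMap A y := ⟨.const X y, fun _ _ => rfl⟩

instance (A : Set X) (y : Y) : Zero (PairClass A (Path.refl y)) := ⟨.mk (.const A _)⟩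

instance (A : Set X) (y : Y) : Add (PairClass A (Path.refl y)) where
  add := Quotient.map₂ PairMap.concat (by
    rintro f f' ⟨H⟩ g g' ⟨K⟩
    refine PairMap.rel_of ⟨fun p => (H p).trans (K p), H.continuous.path_trans K.continuous⟩ ?_ ?_ ?_
    · intro x
      change (H (0, x)).trans (K (0, x)) = (f.1 x).trans (g.1 x)
      rw [H.apply_zero, K.apply_zero]
    · intro x
      change (H (1, x)).trans (K (1, x)) = (f'.1 x).trans (g'.1 x)
      rw [H.apply_one, K.apply_one]
    · intro t a ha
      change (H (t, a)).trans (K (t, a)) = _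
      rw [H.eq_fst t ha, K.eq_fst t ha, f.2 a ha, g.2 a ha, Path.refl_trans_refl])

instance (A : Set X) (y : Y) : Neg (PairClass A (Path.refl y)) where
  neg := Quotient.map PairMap.reverse (by
    rintro f f' ⟨H⟩
    refine PairMap.rel_of ⟨fun p => (H p).symm, Path.continuous_symm.comp H.continuous⟩ ?_ ?_ ?_
    · intro x
      change (H (0, x)).symm = (f.1 x).symm
      rw [H.apply_zero]
    · intro x
      change (H (1, x)).symm = (f'.1 x).symm
      rw [H.apply_one]
    · intro t a ha
      change (H (t, a)).symm = _
      rw [H.eq_fst t ha, f.2 a ha, Path.refl_symm])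

/-- A homotopy of families of loops obtained by reparametrizing one family of loops. -/
theorem PairClass.reparam {A : Set X} {y : Y} (p f g : PairMap A (Path.refl y)) (k : I × I → ℝ)
    (hk : Continuous k) (k0 : ∀ t, k (t, 0) ≤ 0 ∨ 1 ≤ k (t, 0))
    (k1 : ∀ t, k (t, 1) ≤ 0 ∨ 1 ≤ k (t, 1))
    (h0 : ∀ x s, (p.1 x).extend (k (0, s)) = f.1 x s)
    (h1 : ∀ x s, (p.1 x).extend (k (1, s)) = g.1 x s) :
    PairClass.mk f = PairClass.mk g := by
  have key : ∀ (γ : Path y y) (r : ℝ), r ≤ 0 ∨ 1 ≤ r → γ.extend r = y := by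
    rintro γ r (h | h)
    · exact γ.extend_of_le_zero h
    · exact γ.extend_of_one_le h
  have hc : Continuous ↿(fun q : (I × X) × I => p.1 q.1.2) :=
    Path.continuous_uncurry_iff.mpr (p.1.continuous.comp (by fun_prop))
  let H : I × X → Path y y := fun q =>
    { toFun := fun s => (p.1 q.2).extend (k (q.1, s))
      continuous_toFun := (p.1 q.2).continuous_extend.comp (hk.comp (by fun_prop))
      source' := key _ _ (k0 _)
      target' := key _ _ (k1 _) }
  have hH : Continuous H := by
    rw [← Path.continuous_uncurry_iff]
    exact Continuous.pathExtend (γ := fun q : (I × X) × I => p.1 q.1.2)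
      (f := fun q => k (q.1.1, q.2)) hc (hk.comp (by fun_prop))
  refine PairClass.sound ⟨H, hH⟩ ?_ ?_ ?_
  · intro x; ext s; exact h0 x s
  · intro x; ext s; exact h1 x s
  · intro t a ha
    ext s
    change (p.1 a).extend _ = _
    rw [p.2 a ha, Path.refl_extend]
    rfl

theorem PairClass.loop_add_assoc {A : Set X} {y : Y} (a b c : PairClass A (Path.refl y)) :
    a + b + c = a + (b + c) := by
  induction a using Quotient.inductionOn with | _ a =>
  induction b using Quotient.inductionOn with | _ b =>
  induction c using Quotient.inductionOn with | _ c =>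
  refine PairClass.reparam (a.concat (b.concat c)) _ _
    (fun q => (1 - (q.1 : ℝ)) * Path.Homotopy.transAssocReparamAux q.2 + q.1 * q.2)
    (by fun_prop) ?_ ?_ ?_ ?_
  · intro t; left; simp [Path.Homotopy.transAssocReparamAux_zero]
  · intro t; right; simp [Path.Homotopy.transAssocReparamAux_one]
  · intro x s
    have := DFunLike.congr_fun (Path.Homotopy.trans_assoc_reparam (a.1 x) (b.1 x) (c.1 x)) s
    refine Eq.trans ?_ this.symm
    simp only [Set.Icc.coe_zero, sub_zero, one_mul, zero_mul, add_zero]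
    exact Path.extend_apply _ (Path.Homotopy.transAssocReparamAux_mem_I s)
  · intro x s
    simp only [Set.Icc.coe_one, sub_self, one_mul, zero_mul, zero_add]
    exact Path.extend_apply _ s.2

theorem PairClass.loop_zero_add {A : Set X} {y : Y} (a : PairClass A (Path.refl y)) :
    0 + a = a := by
  induction a using Quotient.inductionOn with | _ a =>
  refine PairClass.reparam a _ _
    (fun q => (1 - (q.1 : ℝ)) * (2 * q.2 - 1) + q.1 * q.2) (by fun_prop) ?_ ?_ ?_ ?_
  · intro t; left
    have := t.2.2
    simpa using this
  · intro t; right; norm_num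
  · intro x s
    simp only [Set.Icc.coe_zero, sub_zero, one_mul, zero_mul, add_zero]
    change _ = if (s : ℝ) ≤ 1 / 2 then (Path.refl y).extend _ else (a.1 x).extend _
    split_ifs with h
    · rw [Path.extend_of_le_zero _ (by linarith)]
      simp
    · rfl
  · intro x s
    simp only [Set.Icc.coe_one, sub_self, one_mul, zero_mul, zero_add]
    exact Path.extend_apply _ s.2

theorem PairClass.loop_neg_add {A : Set X} {y : Y} (a : PairClass A (Path.refl y)) :
    -a + a = 0 := by
  induction a using Quotient.inductionOn with | _ a =>
  refine Eq.symm (PairClass.reparam a.reverse _ _ Path.Homotopy.reflTransSymmAux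
    (by fun_prop) ?_ ?_ ?_ ?_)
  · intro t; left; norm_num [Path.Homotopy.reflTransSymmAux]
  · intro t; left; norm_num [Path.Homotopy.reflTransSymmAux]
  · intro x s
    have := DFunLike.congr_fun ((Path.Homotopy.reflTransSymm (a.1 x).symm).eval_zero) s
    refine Eq.trans ?_ this
    exact Path.extend_apply _ (Path.Homotopy.reflTransSymmAux_mem_I (0, s))
  · intro x s
    have := DFunLike.congr_fun ((Path.Homotopy.reflTransSymm (a.1 x).symm).eval_one) s
    refine Eq.trans ?_ (this.trans ?_)
    · exact Path.extend_apply _ (Path.Homotopy.reflTransSymmAux_mem_I (1, s))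
    · rw [Path.symm_symm]; rfl

/-- The group of homotopy classes of maps into a loop space, under pointwise concatenation. -/
instance loopAddGroup (A : Set X) (y : Y) : AddGroup (PairClass A (Path.refl y)) :=
  AddGroup.ofLeftAxioms PairClass.loop_add_assoc PairClass.loop_zero_add PairClass.loop_neg_add

/-- Interchanging the two loop coordinates of a double loop. -/
def loopSwap (y : Y) :
    C(Path (Path.refl y) (Path.refl y), Path (Path.refl y) (Path.refl y)) where
  toFun p :=
    { toFun := fun s =>
        { toFun := fun u => p u s
          continuous_toFun := by fun_prop
          source' := by simp
          target' := by simp }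
      continuous_toFun := by
        rw [← Path.continuous_uncurry_iff]
        change Continuous fun q : I × I => p q.2 q.1
        fun_prop
      source' := by ext u; exact (p u).source
      target' := by ext u; exact (p u).target }
  continuous_toFun := by
    rw [← Path.continuous_uncurry_iff, ← Path.continuous_uncurry_iff]
    change Continuous fun q : (Path (Path.refl y) (Path.refl y) × I) × I => q.1.1 q.2 q.1.2
    fun_prop

theorem loopSwap_refl (y : Y) :
    loopSwap y (Path.refl (Path.refl y)) = Path.refl (Path.refl y) := rfl

theorem PairClass.push_loopSwap {A : Set X} {y : Y}
    (a : PairClass A (Path.refl (Path.refl y))) :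
    push (loopSwap y) (loopSwap_refl y) (push (loopSwap y) (loopSwap_refl y) a) = a := by
  induction a using Quotient.inductionOn with | _ a => rfl

theorem PairClass.interchange {A : Set X} {y : Y}
    (a b c d : PairClass A (Path.refl (Path.refl y))) :
    let T : PairClass A (Path.refl (Path.refl y)) → PairClass A (Path.refl (Path.refl y)) :=
      push (loopSwap y) (loopSwap_refl y)
    T (T a + T b) + T (T c + T d) = T (T (a + c) + T (b + d)) := by
  induction a using Quotient.inductionOn with | _ a =>
  induction b using Quotient.inductionOn with | _ b =>
  induction c using Quotient.inductionOn with | _ c =>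
  induction d using Quotient.inductionOn with | _ d =>
  refine congrArg PairClass.mk (Subtype.ext (ContinuousMap.ext fun x => ?_))
  ext s u
  change (Path.trans (loopSwap y (Path.trans (loopSwap y (a.1 x)) (loopSwap y (b.1 x))))
      (loopSwap y (Path.trans (loopSwap y (c.1 x)) (loopSwap y (d.1 x))))) s u =
    (Path.trans (loopSwap y ((a.1 x).trans (c.1 x))) (loopSwap y ((b.1 x).trans (d.1 x)))) u s
  have sw : ∀ (p : Path (Path.refl y) (Path.refl y)) (s u : I), loopSwap y p s u = p u s :=
    fun _ _ _ => rfl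
  by_cases hs : (s : ℝ) ≤ 1 / 2 <;> by_cases hu : (u : ℝ) ≤ 1 / 2 <;>
    simp only [Path.trans_apply (t := s), Path.trans_apply (t := u), hs, hu, dite_true,
      dite_false, sw]

theorem PairClass.double_loop_add_comm {A : Set X} {y : Y}
    (a b : PairClass A (Path.refl (Path.refl y))) : a + b = b + a := by
  let T : PairClass A (Path.refl (Path.refl y)) → PairClass A (Path.refl (Path.refl y)) :=
    push (loopSwap y) (loopSwap_refl y)
  have hT : ∀ a, T (T a) = a := push_loopSwap
  have h0 : T 0 = 0 := rfl
  exact (EckmannHilton.mul_comm (m₁ := fun a b => T (T a + T b)) (m₂ := fun a b => a + b)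
    (e₁ := 0) (e₂ := 0)
    { left_id := fun a => by simp [h0, hT], right_id := fun a => by simp [h0, hT] }
    { left_id := zero_add, right_id := add_zero }
    (fun a b c d => (interchange a c b d).symm)).comm a b

/-- The map of loop spaces induced by a pointed map. -/
def loopMap {y : Y} {z : Z} (φ : C(Y, Z)) (hφ : φ y = z) : C(Path y y, Path z z) where
  toFun γ := (γ.map φ.continuous).cast hφ.symm hφ.symm
  continuous_toFun := by
    rw [← Path.continuous_uncurry_iff]
    change Continuous fun q : Path y y × I => φ (q.1 q.2)
    fun_prop

theorem loopMap_refl {y : Y} {z : Z} (φ : C(Y, Z)) (hφ : φ y = z) :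
    loopMap φ hφ (Path.refl y) = Path.refl z := by
  ext s; exact hφ

theorem PairClass.push_loopMap_add {A : Set X} {y : Y} {z : Z} (φ : C(Y, Z)) (hφ : φ y = z)
    (a b : PairClass A (Path.refl y)) :
    push (loopMap φ hφ) (loopMap_refl φ hφ) (a + b) =
      push (loopMap φ hφ) (loopMap_refl φ hφ) a + push (loopMap φ hφ) (loopMap_refl φ hφ) b := by
  subst hφ
  induction a using Quotient.inductionOn with | _ a =>
  induction b using Quotient.inductionOn with | _ b =>
  refine congrArg PairClass.mk (Subtype.ext (ContinuousMap.ext fun x => ?_))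
  exact Path.map_trans (a.1 x) (b.1 x) φ.continuous

theorem loopMap_homotopic {y : Y} {z : Z} {φ : C(Y, Z)} {ψ : C(Z, Y)}
    (hφ : φ y = z) (hψ : ψ z = y) (h : (ψ.comp φ).HomotopicRel (ContinuousMap.id Y) {y}) :
    ((loopMap ψ hψ).comp (loopMap φ hφ)).HomotopicRel (ContinuousMap.id (Path y y))
      {Path.refl y} := by
  obtain ⟨H⟩ := h
  let K : I × Path y y → Path y y := fun q =>
    { toFun := fun s => H (q.1, q.2 s)
      continuous_toFun := by fun_prop
      source' := by rw [q.2.source]; exact H.eq_snd q.1 rfl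
      target' := by rw [q.2.target]; exact H.eq_snd q.1 rfl }
  have hK : Continuous K := by
    rw [← Path.continuous_uncurry_iff]
    change Continuous fun r : (I × Path y y) × I => H (r.1.1, r.1.2 r.2)
    fun_prop
  refine ⟨⟨⟨⟨K, hK⟩, ?_, ?_⟩, ?_⟩⟩
  · intro γ; ext s; exact H.apply_zero _
  · intro γ; ext s; exact H.apply_one _
  · rintro t γ rfl
    ext s
    change H (t, y) = ψ (φ y)
    exact H.eq_fst t rfl

theorem PairClass.pull_loop_add {A : Set X} {A' : Set X'} {y : Y} (f : C(X, X'))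
    (hf : Set.MapsTo f A A') (a b : PairClass A' (Path.refl y)) :
    pull f hf (a + b) = pull f hf a + pull f hf b := by
  induction a using Quotient.inductionOn with | _ a =>
  induction b using Quotient.inductionOn with | _ b => rfl

theorem PairClass.push_pull {A : Set X} {A' : Set X'} {y : Y} {z : Z} (f : C(X, X'))
    (hf : Set.MapsTo f A A') (φ : C(Y, Z)) (hφ : φ y = z) (a : PairClass A' y) :
    push φ hφ (pull f hf a) = pull f hf (push φ hφ a) := by
  induction a using Quotient.inductionOn with | _ a => rfl

end Loops

/-! ### Spectra and generalized cohomology -/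

/-- A pointed homotopy equivalence between the pointed spaces `(Y, y)` and `(Z, z)`. -/
structure PtdHomotopyEquiv {Y Z : Type*} [TopologicalSpace Y] [TopologicalSpace Z]
    (y : Y) (z : Z) where
  /-- The underlying map. -/
  toFun : C(Y, Z)
  /-- A pointed homotopy inverse. -/
  invFun : C(Z, Y)
  map_pt : toFun y = z
  inv_pt : invFun z = y
  left_inv : (invFun.comp toFun).HomotopicRel (ContinuousMap.id Y) {y}
  right_inv : (toFun.comp invFun).HomotopicRel (ContinuousMap.id Z) {z}

/-- An `Ω`-spectrum: pointed spaces `F n`, `n : ℤ`, with pointed homotopy equivalences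
`F m ≃ Ω (F n)` whenever `m + 1 = n`. -/
structure OmegaSpectrum where
  /-- The spaces of the spectrum. -/
  space : ℤ → Type v
  [top : ∀ n, TopologicalSpace (space n)]
  /-- The basepoints. -/
  pt : ∀ n, space n
  /-- The structure maps `F m ≃ Ω (F n)`, where `n = m + 1`. -/
  equiv : ∀ {m n : ℤ}, m + 1 = n → PtdHomotopyEquiv (pt m) (Path.refl (pt n))

attribute [instance] OmegaSpectrum.top

namespace OmegaSpectrum

variable (E : OmegaSpectrum.{v}) {X X' Y : Type*} [TopologicalSpace X] [TopologicalSpace X']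
  [TopologicalSpace Y]

/-- The bijection `⟨X/A, F m⟩ ≃ ⟨X/A, Ω (F n)⟩` for `m + 1 = n`. -/
def loopEquiv {m n : ℤ} (h : m + 1 = n) (A : Set X) :
    PairClass A (E.pt m) ≃ PairClass A (Path.refl (E.pt n)) where
  toFun := PairClass.push (E.equiv h).toFun (E.equiv h).map_pt
  invFun := PairClass.push (E.equiv h).invFun (E.equiv h).inv_pt
  left_inv := PairClass.push_push_of_homotopic _ _ (E.equiv h).left_inv
  right_inv := PairClass.push_push_of_homotopic _ _ (E.equiv h).right_inv

theorem loop_add_comm {n : ℤ} {A : Set X} (a b : PairClass A (Path.refl (E.pt n))) :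
    a + b = b + a := by
  let e := E.equiv (rfl : n + 1 = n + 1)
  have inj : Function.Injective (PairClass.push (A := A) (loopMap e.toFun e.map_pt)
      (loopMap_refl e.toFun e.map_pt)) :=
    Function.LeftInverse.injective (PairClass.push_push_of_homotopic _
      (loopMap_refl e.invFun e.inv_pt) (loopMap_homotopic e.map_pt e.inv_pt e.left_inv))
  apply inj
  rw [PairClass.push_loopMap_add, PairClass.push_loopMap_add, PairClass.double_loop_add_comm]

/-- The abelian group structure on `⟨X/A, F n⟩`, transported from the concatenation of loops along
the bijection with `⟨X/A, Ω (F (n + 1))⟩`. -/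
instance addCommGroup (n : ℤ) (A : Set X) : AddCommGroup (PairClass A (E.pt n)) :=
  { (E.loopEquiv (rfl : n + 1 = n + 1) A).addGroup with
    add_comm := fun a b => (E.loopEquiv (rfl : n + 1 = n + 1) A).injective
      (by
        change E.loopEquiv _ A ((E.loopEquiv _ A).symm _) = E.loopEquiv _ A ((E.loopEquiv _ A).symm _)
        rw [Equiv.apply_symm_apply, Equiv.apply_symm_apply]
        exact E.loop_add_comm _ _) }

theorem loopEquiv_add {n : ℤ} {A : Set X} (a b : PairClass A (E.pt n)) :
    E.loopEquiv rfl A (a + b) = E.loopEquiv rfl A a + E.loopEquiv rfl A b :=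
  (E.loopEquiv rfl A).apply_symm_apply _

theorem loopEquiv_pull {n : ℤ} {A : Set X} {A' : Set X'} (f : C(X, X'))
    (hf : Set.MapsTo f A A') (a : PairClass A' (E.pt n)) :
    E.loopEquiv (rfl : n + 1 = n + 1) A (PairClass.pull f hf a) =
      PairClass.pull f hf (E.loopEquiv rfl A' a) :=
  PairClass.push_pull f hf (E.equiv rfl).toFun (E.equiv rfl).map_pt a

/-- The unreduced cohomology group `hⁿ(X) = [X, F n]`. -/
abbrev h (n : ℤ) (X : Type*) [TopologicalSpace X] : Type _ := PairClass (∅ : Set X) (E.pt n)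

/-- The reduced cohomology group `h̃ⁿ(X, x₀) = ⟨X, F n⟩`. -/
abbrev hred (n : ℤ) {X : Type*} [TopologicalSpace X] (x₀ : X) : Type _ :=
  PairClass ({x₀} : Set X) (E.pt n)

/-- The homomorphism induced by a map of pairs. -/
def pull (n : ℤ) {A : Set X} {A' : Set X'} (f : C(X, X')) (hf : Set.MapsTo f A A') :
    PairClass A' (E.pt n) →+ PairClass A (E.pt n) :=
  AddMonoidHom.mk' (PairClass.pull f hf) fun a b => by
    apply (E.loopEquiv (rfl : n + 1 = n + 1) A).injective
    rw [loopEquiv_add, loopEquiv_pull, loopEquiv_pull, loopEquiv_pull, loopEquiv_add,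
      PairClass.pull_loop_add]

/-- The homomorphism `f^* : hⁿ(X') → hⁿ(X)` induced by a map `f : X → X'`. -/
def hMap (n : ℤ) (f : C(X, X')) : E.h n X' →+ E.h n X :=
  E.pull n f (Set.mapsTo_empty f _)

/-- The homomorphism `f^* : h̃ⁿ(X', x₁) → h̃ⁿ(X, x₀)` induced by a pointed map `f : X → X'`. -/
def hredMap (n : ℤ) {x₀ : X} {x₁ : X'} (f : C(X, X')) (hf : f x₀ = x₁) :
    E.hred n x₁ →+ E.hred n x₀ :=
  E.pull n f (by rintro _ rfl; exact hf)

/-- The homomorphism `h̃ⁿ(X, x₀) → hⁿ(X)` that forgets the basepoint. -/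
def forget (n : ℤ) (x₀ : X) : E.hred n x₀ →+ E.h n X :=
  E.pull n (ContinuousMap.id X) (Set.empty_subset _)

/-- Evaluation of a loop, given on `[0, 1]`, at a point of the circle `ℝ / ℤ`. -/
def circleEval {Z : Type*} [TopologicalSpace Z] {z : Z} (γ : Path z z) : UnitAddCircle → Z :=
  AddCircle.liftIco 1 0 γ.extend

theorem circleEval_coe {Z : Type*} [TopologicalSpace Z] {z : Z} (γ : Path z z) (s : I) :
    circleEval γ ((s : ℝ) : UnitAddCircle) = γ s := by
  rcases s.2.2.lt_or_eq with h | h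
  · rw [circleEval, AddCircle.liftIco_zero_coe_apply ⟨s.2.1, h⟩]
    exact Path.extend_apply _ s.2
  · have hs : s = 1 := Subtype.ext h
    subst hs
    have : (((1 : I) : ℝ) : UnitAddCircle) = ((0 : ℝ) : UnitAddCircle) := by
      simp
    rw [this, circleEval, AddCircle.liftIco_zero_coe_apply ⟨le_rfl, one_pos⟩]
    simp

theorem isProperMap_circle : IsProperMap fun s : I => ((s : ℝ) : UnitAddCircle) :=
  Continuous.isProperMap ((AddCircle.continuous_mk' 1).comp continuous_subtype_val)

theorem surjective_circle : Function.Surjective fun s : I => ((s : ℝ) : UnitAddCircle) := by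
  intro q
  obtain ⟨x, hx, rfl⟩ : q ∈ ((↑) : ℝ → UnitAddCircle) '' Set.Icc 0 (0 + 1) := by
    rw [AddCircle.coe_image_Icc_eq]; trivial
  exact ⟨⟨x, by simpa using hx⟩, rfl⟩

theorem continuous_circleEval {Z : Type*} [TopologicalSpace Z] {z : Z} :
    Continuous fun q : UnitAddCircle × Path z z => circleEval q.2 q.1 := by
  have hq : Topology.IsQuotientMap
      (Prod.map (fun s : I => ((s : ℝ) : UnitAddCircle)) (id : Path z z → Path z z)) :=
    (isProperMap_circle.prodMap isProperMap_id).isClosedMap.isQuotientMap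
      (isProperMap_circle.prodMap isProperMap_id).continuous
      (surjective_circle.prodMap Function.surjective_id)
  rw [hq.continuous_iff]
  have : ((fun q : UnitAddCircle × Path z z => circleEval q.2 q.1) ∘
      Prod.map (fun s : I => ((s : ℝ) : UnitAddCircle)) id) = fun q : I × Path z z => q.2 q.1 := by
    funext q; exact circleEval_coe q.2 q.1
  rw [this]
  fun_prop

/-- The map `[Y, Ω Z] → ⟨(S¹ × Y)/({s₀} × Y), Z⟩` that sends the class of `c` to the class of
`(s, y) ↦ c y s`. Here `S¹ = ℝ / ℤ` has the basepoint `s₀ = 0`. -/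
def uncurryLoop {Z : Type*} [TopologicalSpace Z] {z : Z} :
    PairClass (∅ : Set Y) (Path.refl z) →
      PairClass ({p | p.1 = 0} : Set (UnitAddCircle × Y)) z :=
  Quotient.map' (fun c => ⟨⟨fun p => circleEval (c.1 p.2) p.1,
      continuous_circleEval.comp (continuous_fst.prodMk (c.1.continuous.comp continuous_snd))⟩, by
        rintro ⟨s, y⟩ rfl
        exact (circleEval_coe (c.1 y) 0).trans (c.1 y).source⟩) (by
    rintro c c' ⟨H⟩
    refine PairMap.rel_of ⟨fun q => circleEval (H (q.1, q.2.2)) q.2.1,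
      continuous_circleEval.comp (.prodMk (by fun_prop) (H.continuous.comp (by fun_prop)))⟩ ?_ ?_ ?_
    · rintro ⟨s, y⟩
      exact congrArg (fun γ => circleEval γ s) (H.apply_zero y)
    · rintro ⟨s, y⟩
      exact congrArg (fun γ => circleEval γ s) (H.apply_one y)
    · rintro t ⟨s, y⟩ rfl
      exact (circleEval_coe (H (t, y)) 0).trans (Path.source _))

end OmegaSpectrum

/-! ### Classifying spaces -/

/-- A Hausdorff group in the compactly generated sense: inversion is continuous, and multiplication
is continuous for the compactly generated product topology on `G × G`. Every Hausdorff topological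
group is of this kind. -/
class CGGroup (G : Type*) [Group G] [TopologicalSpace G] : Prop extends T2Space G where
  mul_continuous : Continuous fun p : 𝐤 (G × G) =>
    ((CompactCoherentification.mk (G × G)).symm p).1 *
      ((CompactCoherentification.mk (G × G)).symm p).2
  inv_continuous : Continuous fun g : G => g⁻¹

instance (priority := 50) CGGroup.of_isTopologicalGroup (G : Type*) [Group G] [TopologicalSpace G]
    [IsTopologicalGroup G] [T2Space G] : CGGroup G where
  mul_continuous :=
    (ContinuousMul.continuous_mul (M := G)).comp CompactCoherentification.continuous_mk_symm
  inv_continuous := ContinuousInv.continuous_inv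

instance CGGroup.prod (G H : Type*) [Group G] [TopologicalSpace G] [CGGroup G] [Group H]
    [TopologicalSpace H] [CGGroup H] : CGGroup (G × H) where
  mul_continuous := by
    refine Continuous.prodMk ?_ ?_
    · exact (CGGroup.mul_continuous (G := G)).comp
        (CompactCoherentification.continuous_map_of_continuous
          (f := fun p : (G × H) × (G × H) => (p.1.1, p.2.1)) (by fun_prop))
    · exact (CGGroup.mul_continuous (G := H)).comp
        (CompactCoherentification.continuous_map_of_continuous
          (f := fun p : (G × H) × (G × H) => (p.1.2, p.2.2)) (by fun_prop))
  inv_continuous := by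
    refine Continuous.prodMk ?_ ?_
    · exact (CGGroup.inv_continuous (G := G)).comp continuous_fst
    · exact (CGGroup.inv_continuous (G := H)).comp continuous_snd

section Bar

variable (G : Type*) [Group G] [TopologicalSpace G]

/-- The points `(n, t, (g₁, …, gₙ))` of the disjoint union `∐ₙ Δⁿ × Gⁿ`, where `Gⁿ` carries the
compactly generated product topology. -/
abbrev BarPoint : Type _ := Σ n : ℕ, stdSimplex ℝ (Fin (n + 1)) × 𝐤 (Fin n → G)

variable {G}

/-- The simplicial operator `θ^* : Gⁿ → Gᵐ` of the bar construction for a monotone map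
`θ : {0, …, m} → {0, …, n}`. The `j`-th entry of `θ^* x` is the product `x_{θ(j-1)+1} ⋯ x_{θ(j)}`,
which is written as a quotient of two partial products `x₁ ⋯ x_i`. -/
def barOp {m n : ℕ} (θ : Fin (m + 1) →o Fin (n + 1)) (x : Fin n → G) : Fin m → G :=
  fun j => (Fin.partialProd x (θ j.castSucc))⁻¹ * Fin.partialProd x (θ j.succ)

/-- The relation `(θ_* t, x) ∼ (t, θ^* x)` that defines the geometric realization. -/
inductive BarRel : BarPoint G → BarPoint G → Prop
  | glue {m n : ℕ} (θ : Fin (m + 1) →o Fin (n + 1)) (t : stdSimplex ℝ (Fin (m + 1)))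
      (x : Fin n → G) :
      BarRel ⟨n, stdSimplex.map θ t, .mk _ x⟩ ⟨m, t, .mk _ (barOp θ x)⟩

variable (G)

/-- The classifying space `BG`: the geometric realization of the bar construction of `G`, with the
quotient topology. -/
def B : Type _ := Quot (BarRel (G := G))

instance : TopologicalSpace (B G) := inferInstanceAs (TopologicalSpace (Quot BarRel))

/-- The basepoint of `BG`, the unique vertex of the bar construction. -/
def B.base : B G := Quot.mk _ ⟨0, stdSimplex.vertex 0, .mk _ Fin.elim0⟩

variable {G} {H : Type*} [Group H] [TopologicalSpace H]

theorem barOp_map {G H : Type*} [Group G] [Group H] {m n : ℕ} (θ : Fin (m + 1) →o Fin (n + 1)) (φ : G →* H) (x : Fin n → G) :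
    barOp θ (φ ∘ x) = φ ∘ barOp θ x := by
  have key : ∀ i : Fin (n + 1), Fin.partialProd (φ ∘ x) i = φ (Fin.partialProd x i) := by
    intro i
    simp [Fin.partialProd, map_list_prod, List.map_take, List.map_ofFn]
  funext j
  simp [barOp, key]

/-- The pointed map `BG → BH` induced by a continuous homomorphism `φ : G → H`. -/
def B.map (φ : G →ₜ* H) : C(B G, B H) where
  toFun := Quot.map (fun p => ⟨p.1, p.2.1, CompactCoherentification.map (φ ∘ ·) p.2.2⟩) (by
    rintro _ _ ⟨θ, t, x⟩
    have h := BarRel.glue θ t (φ ∘ x)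
    have e : barOp θ (φ ∘ x) = φ ∘ barOp θ x := barOp_map θ φ.toMonoidHom x
    rw [e] at h
    exact h)
  continuous_toFun := by
    refine continuous_quot_lift _ (continuous_quot_mk.comp ?_)
    refine continuous_sigma fun n => ?_
    have h : Continuous (CompactCoherentification.map (fun x : Fin n → G => φ ∘ x)) :=
      CompactCoherentification.continuous_map_of_continuous
        (continuous_pi fun i => (map_continuous φ).comp (continuous_apply i))
    exact (@continuous_sigmaMk ℕ (fun n : ℕ =>
      stdSimplex ℝ (Fin (n + 1)) × 𝐤 (Fin n → H)) _ n).comp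
        (continuous_fst.prodMk (h.comp continuous_snd))

theorem B.map_base (φ : G →ₜ* H) : B.map φ (B.base G) = B.base H := by
  have : (φ ∘ Fin.elim0 : Fin 0 → H) = Fin.elim0 := Subsingleton.elim _ _
  exact congrArg (fun x => (Quot.mk _ (⟨0, stdSimplex.vertex 0, CompactCoherentification.mk _ x⟩ :
    BarPoint H) : B H)) this

theorem partialProd_barOp {G : Type*} [Group G] {m n : ℕ} (θ : Fin (m + 1) →o Fin (n + 1)) (x : Fin n → G)
    (j : Fin (m + 1)) : Fin.partialProd (barOp θ x) j =
      (Fin.partialProd x (θ 0))⁻¹ * Fin.partialProd x (θ j) := by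
  induction j using Fin.induction with
  | zero => simp
  | succ j ih => rw [Fin.partialProd_succ, ih]; simp [barOp]

/-- The partial sum `k₁ + ⋯ + kᵢ`, as a real number. -/
def partialSum {n : ℕ} (k : Fin n → Multiplicative ℤ) (i : Fin (n + 1)) : ℝ :=
  ((Fin.partialProd k i).toAdd : ℝ)

/-- The canonical homotopy equivalence `Bℤ → S¹ = ℝ / ℤ`. On the universal cover it is the affine
extension `∑ tᵢ eᵢ ↦ ∑ tᵢ (k₁ + ⋯ + kᵢ)` of the inclusion `ℤ ⊆ ℝ`. -/
def B.toCircle : C(B (Multiplicative ℤ), UnitAddCircle) where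
  toFun := Quot.lift (fun p => ((∑ i, p.2.1 i *
      partialSum ((CompactCoherentification.mk _).symm p.2.2) i : ℝ) : UnitAddCircle)) (by
    rintro _ _ ⟨θ, t, x⟩
    rename_i m n
    have e1 : ∑ i, stdSimplex.map θ t i * partialSum x i = ∑ j, t j * partialSum x (θ j) := by
      simp only [stdSimplex.map_coe, FunOnFinite.linearMap_apply_apply, Finset.sum_mul]
      rw [← Finset.sum_fiberwise Finset.univ θ]
      refine Finset.sum_congr rfl fun i _ => Finset.sum_congr rfl fun j hj => ?_
      rw [(Finset.mem_filter.mp hj).2]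
    have e2 : ∑ j, t j * partialSum (barOp θ x) j =
        ∑ j, t j * partialSum x (θ j) - partialSum x (θ 0) := by
      have : ∀ j, partialSum (barOp θ x) j = partialSum x (θ j) - partialSum x (θ 0) := by
        intro j
        simp [partialSum, partialProd_barOp, sub_eq_neg_add]
      simp only [this, mul_sub, Finset.sum_sub_distrib, ← Finset.sum_mul, stdSimplex.sum_eq_one,
        one_mul]
    change ((∑ i, stdSimplex.map θ t i * partialSum x i : ℝ) : UnitAddCircle) =
      ((∑ j, t j * partialSum (barOp θ x) j : ℝ) : UnitAddCircle)
    rw [e1, e2, AddCircle.coe_sub]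
    have : ((partialSum x (θ 0) : ℝ) : UnitAddCircle) = 0 :=
      (AddCircle.coe_eq_zero_iff 1).mpr ⟨(Fin.partialProd x (θ 0)).toAdd, by simp [partialSum]⟩
    rw [this, sub_zero])
  continuous_toFun := by
    refine continuous_quot_lift _ (continuous_sigma fun n => ?_)
    have h : Continuous fun a : stdSimplex ℝ (Fin (n + 1)) × 𝐤 (Fin n → Multiplicative ℤ) =>
        ∑ i, a.1 i * partialSum ((CompactCoherentification.mk _).symm a.2) i := ?_
    · exact (AddCircle.continuous_mk' 1).comp h
    refine continuous_finsetSum _ fun i _ => Continuous.mul ?_ ?_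
    · exact (continuous_apply i).comp (continuous_subtype_val.comp continuous_fst)
    · have : Continuous fun x : Fin n → Multiplicative ℤ => partialSum x i :=
        continuous_of_discreteTopology
      exact this.comp (CompactCoherentification.continuous_mk_symm.comp continuous_snd)

theorem B.toCircle_base : B.toCircle (B.base (Multiplicative ℤ)) = 0 := by
  change ((∑ i, (stdSimplex.vertex 0 : stdSimplex ℝ (Fin 1)) i *
    partialSum Fin.elim0 i : ℝ) : UnitAddCircle) = 0
  simp [partialSum]

end Bar

/-! ### The maps of the decomposition for `ℤ × G` -/

section Decomposition

/-- The group `ℤ × G`, written multiplicatively. -/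
abbrev ZProd (G : Type*) : Type _ := Multiplicative ℤ × G

/-- The comparison map `B(ℤ × G) → Bℤ × BG → S¹ × BG`. -/
def B.compare (G : Type*) [Group G] [TopologicalSpace G] : C(B (ZProd G), UnitAddCircle × B G) :=
  (B.toCircle.comp (B.map (ContinuousMonoidHom.fst (Multiplicative ℤ) G))).prodMk
    (B.map (ContinuousMonoidHom.snd (Multiplicative ℤ) G))

theorem B.compare_base (G : Type*) [Group G] [TopologicalSpace G] :
    (B.compare G (B.base (ZProd G))).1 = 0 := by
  change B.toCircle (B.map (ContinuousMonoidHom.fst (Multiplicative ℤ) G) (B.base (ZProd G))) = 0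
  rw [B.map_base, B.toCircle_base]

/-- The homomorphism `id × φ : ℤ × G → ℤ × H`. -/
def zprodMap {G H : Type*} [Group G] [TopologicalSpace G] [Group H] [TopologicalSpace H]
    (φ : G →ₜ* H) : ZProd G →ₜ* ZProd H :=
  (ContinuousMonoidHom.id (Multiplicative ℤ)).prodMap φ

namespace OmegaSpectrum

variable (E : OmegaSpectrum.{v}) (d : ℤ)

section Functoriality

variable {G H : Type*} [Group G] [TopologicalSpace G] [Group H] [TopologicalSpace H] (φ : G →ₜ* H)

/-- The homomorphism `φ^* : h^d(BH) → h^d(BG)` induced by `φ : G → H`. -/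
def hB : E.h d (B H) →+ E.h d (B G) := E.hMap d (B.map φ)

/-- The homomorphism `φ^* : h̃^d(BH) → h̃^d(BG)` induced by `φ : G → H`. -/
def hredB : E.hred d (B.base H) →+ E.hred d (B.base G) := E.hredMap d (B.map φ) (B.map_base φ)

end Functoriality

/-- The map `α̃`, the composition
`h^{d-1}(BG) = [BG, F_{d-1}] ≅ [BG, Ω F_d] ≅ ⟨(S¹ × BG)/({s₀} × BG), F_d⟩ → ⟨B(ℤ × G), F_d⟩`,
whose last map is induced by `B(ℤ × G) → Bℤ × BG → S¹ × BG → (S¹ × BG)/({s₀} × BG)`. -/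
def alphaRed (G : Type*) [Group G] [TopologicalSpace G] (c : E.h (d - 1) (B G)) : E.hred d (B.base (ZProd G)) :=
  PairClass.pull (B.compare G) (by rintro _ rfl; exact B.compare_base G)
    (uncurryLoop (E.loopEquiv (sub_add_cancel d 1) ∅ c))

/-- `β̃ : h̃^d(B(ℤ × G)) → h̃^d(BG)`, induced by `G → ℤ × G`, `g ↦ (0, g)`. -/
def betaRed (G : Type*) [Group G] [TopologicalSpace G] :
    E.hred d (B.base (ZProd G)) →+ E.hred d (B.base G) :=
  E.hredB d (ContinuousMonoidHom.inr (Multiplicative ℤ) G)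

/-- `β : h^d(B(ℤ × G)) → h^d(BG)`, induced by `G → ℤ × G`, `g ↦ (0, g)`. -/
def beta (G : Type*) [Group G] [TopologicalSpace G] :
    E.h d (B (ZProd G)) →+ E.h d (B G) :=
  E.hB d (ContinuousMonoidHom.inr (Multiplicative ℤ) G)

/-- The splitting of `β̃` induced by `ℤ × G → G`, `(i, g) ↦ g`. -/
def sigmaRed (G : Type*) [Group G] [TopologicalSpace G] :
    E.hred d (B.base G) →+ E.hred d (B.base (ZProd G)) :=
  E.hredB d (ContinuousMonoidHom.snd (Multiplicative ℤ) G)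

/-- The splitting of `β` induced by `ℤ × G → G`, `(i, g) ↦ g`. -/
def sigma (G : Type*) [Group G] [TopologicalSpace G] :
    E.h d (B G) →+ E.h d (B (ZProd G)) :=
  E.hB d (ContinuousMonoidHom.snd (Multiplicative ℤ) G)

end OmegaSpectrum

end Decomposition

end GenCoh

end

/-! The proof has a geometric half and a homotopical half.

Geometry: `B.compare` from B(ℤ × G) to S¹ × BG has an explicit homotopy inverse `B.uncompare`. A
point of BH is a simplex point t with a tuple v of group elements as vertices, modulo left
translation, and t is read as a subdivision of [0, 1] into intervals labelled by the vertices. Thus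
a point of B(ℤ × G) is a step function with values in ℤ × G. Its height is the integral of the
ℤ-component, and `B.compare` records the height mod 1 together with the G-component. Since any tuple
spans a simplex, the ℤ-component may be replaced freely: on [0, τ] put the step function with value
m up to 1 - φ and m + 1 afterwards, where m + φ is the height (`deform`, `shear`). At τ = 0 nothing
changes; at τ = 1 only the G-component and the height mod 1 matter. Hence the step functions with
values 0 and 1 define `B.uncompare`, with `B.compare_uncompare` a strict identity and
`B.uncompare_compare` a homotopy fixing the basepoint. Superimposing two subdivisions is the passage
to their common refinement (`coupling`), the usual triangulation of a product of simplices.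

Homotopy: in S¹ × Y the slice {0} × Y is a retract with the homotopy extension property. A class
that vanishes on the slice therefore comes from a map sending the slice to the basepoint
(`exists_pull_eq_of_restrict_eq`), that is, from a family of loops (`surjective_uncurryLoop`). A
family of loops that is freely null homotopic on S¹ × Y is null homotopic through based loops, by
conjugation with the track of the basepoint (`eq_zero_of_uncurryLoop_eq`). This gives exactness and
injectivity. Additivity of α̃ is an Eckmann–Hilton argument (`uncurryLoop_loop_add`), and the
splitting holds because G → ℤ × G → G is the identity.

Both rows are handled at once by maps of pairs (B(ℤ × G), A), with A empty or the basepoint. -/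

open scoped unitInterval CompactCoherentification

noncomputable section

namespace GenCoh

/-! ### Points of the classifying space in homogeneous coordinates -/

section Homogeneous

variable {H : Type*} [Group H]

/-- The inhomogeneous bar coordinates `vⱼ₋₁⁻¹ vⱼ` of a tuple of homogeneous coordinates. -/
def barDiff {n : ℕ} (v : Fin (n + 1) → H) : Fin n → H := fun j => (v j.castSucc)⁻¹ * v j.succ

theorem partialProd_barDiff {n : ℕ} (v : Fin (n + 1) → H) (i : Fin (n + 1)) :
    Fin.partialProd (barDiff v) i = (v 0)⁻¹ * v i := by
  induction i using Fin.induction with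
  | zero => simp
  | succ i ih => rw [Fin.partialProd_succ, ih]; simp [barDiff]

/-- This is the reason for homogeneous coordinates: the simplicial operators become mere reindexing,
with no products of group elements. -/
theorem barOp_barDiff {m n : ℕ} (θ : Fin (m + 1) →o Fin (n + 1)) (v : Fin (n + 1) → H) :
    barOp θ (barDiff v) = barDiff (v ∘ θ) := by
  funext j
  simp [barOp, partialProd_barDiff, barDiff, mul_assoc]

theorem barDiff_partialProd {n : ℕ} (x : Fin n → H) : barDiff (Fin.partialProd x) = x := by
  funext j
  simp [barDiff, Fin.partialProd_succ]

theorem barDiff_mul_left {n : ℕ} (c : H) (v : Fin (n + 1) → H) :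
    barDiff (fun i => c * v i) = barDiff v := by
  funext j
  simp [barDiff, mul_assoc]

end Homogeneous

section Simplex

variable {ι κ : Type*} [Fintype ι] [Fintype κ]

theorem stdSimplex_map_apply [DecidableEq κ] (f : ι → κ) (w : stdSimplex ℝ ι) (k : κ) :
    stdSimplex.map f w k = ∑ i with f i = k, w i := by
  classical
  rw [stdSimplex.map_coe, FunOnFinite.linearMap_apply_apply]

theorem sum_stdSimplex_map_mul (f : ι → κ) (w : stdSimplex ℝ ι) (g : κ → ℝ) :
    ∑ k, stdSimplex.map f w k * g k = ∑ i, w i * g (f i) := by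
  classical
  simp only [stdSimplex_map_apply, Finset.sum_mul]
  rw [← Finset.sum_fiberwise Finset.univ f]
  refine Finset.sum_congr rfl fun i _ => Finset.sum_congr rfl fun j hj => ?_
  rw [(Finset.mem_filter.mp hj).2]

/-- The support of a point of a simplex. -/
abbrev Supp (w : stdSimplex ℝ ι) : Type _ := {i // w i ≠ 0}

instance (w : stdSimplex ℝ ι) : Nonempty (Supp w) := by
  by_contra h
  have h0 : ∀ i, w i = 0 := fun i => by_contra fun hi => h ⟨⟨i, hi⟩⟩
  have := stdSimplex.sum_eq_one w
  simp [h0] at this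

instance (w : stdSimplex ℝ ι) : Fintype (Supp w) := Fintype.ofFinite _

/-- A point of a simplex as a point of the open face that contains it. -/
def restrictSupp (w : stdSimplex ℝ ι) : stdSimplex ℝ (Supp w) :=
  ⟨fun i => w i, fun i => stdSimplex.zero_le w i, by
    classical
    have h := Finset.sum_subtype (p := fun i => w i ≠ 0)
      (F := (inferInstance : Fintype (Supp w))) (Finset.univ.filter fun i => w i ≠ 0)
      (by simp) (fun i => w i)
    rw [Finset.sum_filter_ne_zero, stdSimplex.sum_eq_one] at h
    exact h.symm⟩

theorem map_restrictSupp (w : stdSimplex ℝ ι) :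
    stdSimplex.map Subtype.val (restrictSupp w) = w := by
  classical
  ext k
  rw [stdSimplex_map_apply]
  by_cases hk : w k = 0
  · rw [hk]
    refine Finset.sum_eq_zero fun i hi => ?_
    rw [Finset.mem_filter] at hi
    exact absurd (hi.2 ▸ hk) i.2
  · rw [Finset.sum_eq_single ⟨k, hk⟩]
    · rfl
    · intro i hi hne
      exact absurd (Subtype.ext (Finset.mem_filter.mp hi).2) hne
    · simp

end Simplex

section Point

variable {H : Type*} [Group H]
variable {ι κ : Type*} [Fintype ι] [LinearOrder ι] [Nonempty ι] [Fintype κ] [LinearOrder κ]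
  [Nonempty κ]

/-- The increasing enumeration of a nonempty finite linear order. -/
def enum (ι : Type*) [Fintype ι] [LinearOrder ι] [Nonempty ι] :
    Fin (Fintype.card ι - 1 + 1) ≃o ι :=
  Fintype.orderIsoFinOfCardEq ι (Nat.sub_add_cancel Fintype.card_pos).symm

/-- The point of `BH` with barycentric coordinates `w` in the simplex with vertices `v`. -/
def B.point (w : stdSimplex ℝ ι) (v : ι → H) : B H :=
  Quot.mk _ ⟨Fintype.card ι - 1, stdSimplex.map (enum ι).symm w, .mk _ (barDiff (v ∘ enum ι))⟩

theorem B.mk_map {m n : ℕ} (θ : Fin (m + 1) →o Fin (n + 1)) (t : stdSimplex ℝ (Fin (m + 1)))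
    (v : Fin (n + 1) → H) :
    (Quot.mk _ ⟨n, stdSimplex.map θ t, .mk _ (barDiff v)⟩ : B H) =
      Quot.mk _ ⟨m, t, .mk _ (barDiff (v ∘ θ))⟩ := by
  rw [← barOp_barDiff]
  exact Quot.sound (BarRel.glue θ t (barDiff v))

theorem B.point_map (φ : ι →o κ) (w : stdSimplex ℝ ι) (v : κ → H) :
    B.point (stdSimplex.map φ w) v = B.point w (v ∘ φ) := by
  have h := B.mk_map (OrderHom.comp (enum κ).symm.toOrderEmbedding.toOrderHom
    (φ.comp (enum ι).toOrderEmbedding.toOrderHom)) (stdSimplex.map (enum ι).symm w) (v ∘ enum κ)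
  rw [stdSimplex.map_comp_apply] at h
  have e1 : ⇑(OrderHom.comp (enum κ).symm.toOrderEmbedding.toOrderHom
      (φ.comp (enum ι).toOrderEmbedding.toOrderHom)) ∘ (enum ι).symm = (enum κ).symm ∘ φ := by
    funext i; simp
  have e2 : (v ∘ enum κ) ∘ ⇑(OrderHom.comp (enum κ).symm.toOrderEmbedding.toOrderHom
      (φ.comp (enum ι).toOrderEmbedding.toOrderHom)) = (v ∘ φ) ∘ enum ι := by
    funext i; simp
  rw [e1, e2] at h
  unfold B.point
  rw [stdSimplex.map_comp_apply]
  exact h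

theorem B.point_fin {n : ℕ} (t : stdSimplex ℝ (Fin (n + 1))) (v : Fin (n + 1) → H) :
    B.point t v = Quot.mk _ ⟨n, t, .mk _ (barDiff v)⟩ := by
  have h := B.mk_map (enum (Fin (n + 1))).toOrderEmbedding.toOrderHom
    (stdSimplex.map (enum (Fin (n + 1))).symm t) v
  rw [stdSimplex.map_comp_apply] at h
  refine Eq.trans ?_ (h.symm.trans ?_)
  · rfl
  · congr 3
    convert stdSimplex.map_id_apply t using 2
    funext i; simp

theorem B.point_partialProd {n : ℕ} (t : stdSimplex ℝ (Fin (n + 1))) (x : Fin n → H) :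
    B.point t (Fin.partialProd x) = Quot.mk _ ⟨n, t, .mk _ x⟩ := by
  rw [B.point_fin, barDiff_partialProd]

theorem B.exists_point (b : B H) : ∃ (n : ℕ) (t : stdSimplex ℝ (Fin (n + 1)))
    (v : Fin (n + 1) → H), B.point t v = b := by
  induction b using Quot.ind with | _ p =>
  exact ⟨p.1, p.2.1, _, B.point_partialProd p.2.1 ((CompactCoherentification.mk _).symm p.2.2)⟩

/-- The bar coordinates are the quotients of successive vertices, so the diagonal left translation
cancels; this is BH = EH/H. -/
theorem B.point_mul_left (c : H) (w : stdSimplex ℝ ι) (v : ι → H) :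
    B.point w (fun i => c * v i) = B.point w v := by
  unfold B.point
  exact congrArg (fun x => (Quot.mk _ ⟨_, stdSimplex.map (enum ι).symm w, .mk _ x⟩ : B H))
    (barDiff_mul_left c (v ∘ enum ι))

theorem B.point_restrictSupp (w : stdSimplex ℝ ι) (v : ι → H) :
    B.point (restrictSupp w) (fun i => v i) = B.point w v := by
  conv_rhs => rw [← map_restrictSupp w]
  exact (B.point_map ⟨Subtype.val, fun _ _ h => h⟩ (restrictSupp w) v).symm

/-- Vertices of weight zero are invisible, because the point already lies in the face spanned by its
support. -/
theorem B.point_congr {w : stdSimplex ℝ ι} {v v' : ι → H} (h : ∀ i, w i ≠ 0 → v i = v' i) :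
    B.point w v = B.point w v' := by
  rw [← B.point_restrictSupp w v, ← B.point_restrictSupp w v']
  exact congrArg _ (funext fun i => h i i.2)

/-- The gluing relation can be applied inside the face spanned by the support, so monotonicity is
needed only there. Coordinate maps of a lexicographic product are often monotone only in this weaker
sense. -/
theorem B.point_map_of_monotoneOn {φ : ι → κ} {w : stdSimplex ℝ ι}
    (hφ : MonotoneOn φ {i | w i ≠ 0}) (v : κ → H) :
    B.point (stdSimplex.map φ w) v = B.point w (v ∘ φ) := by
  rw [← B.point_restrictSupp w]
  conv_lhs => rw [← map_restrictSupp w, stdSimplex.map_comp_apply]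
  exact B.point_map ⟨fun i : Supp w => φ i, fun i j h => hφ i.2 j.2 h⟩ (restrictSupp w) v

theorem B.point_const (w : stdSimplex ℝ ι) (c : H) : B.point w (fun _ => c) = B.base H := by
  have h := B.point_map ⟨fun _ : ι => (0 : Fin 1), fun _ _ _ => le_rfl⟩ w (fun _ => c)
  refine h.symm.trans ?_
  rw [B.point_fin]
  refine congrArg (Quot.mk _) ?_
  congr 1
  exact congrArg₂ Prod.mk (Subsingleton.elim _ _)
    (congrArg (CompactCoherentification.mk _) (Subsingleton.elim _ _))

theorem B.map_point [TopologicalSpace H] {K : Type*} [Group K] [TopologicalSpace K] (φ : H →ₜ* K)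
    (w : stdSimplex ℝ ι) (v : ι → H) : B.map φ (B.point w v) = B.point w (φ ∘ v) := by
  change (Quot.mk _ ⟨_, _, CompactCoherentification.mk _ (φ ∘ barDiff (v ∘ enum ι))⟩ : B K) = _
  have : φ ∘ barDiff (v ∘ enum ι) = barDiff ((φ ∘ v) ∘ enum ι) := by
    funext j; simp [barDiff]
  rw [this]; rfl

theorem B.toCircle_point (w : stdSimplex ℝ ι) (v : ι → Multiplicative ℤ) :
    B.toCircle (B.point w v) = ((∑ i, w i * ((v i).toAdd : ℝ) : ℝ) : UnitAddCircle) := by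
  change ((∑ i, stdSimplex.map (enum ι).symm w i *
    partialSum (barDiff (v ∘ enum ι)) i : ℝ) : UnitAddCircle) = _
  rw [sum_stdSimplex_map_mul]
  -- Normalizing the first vertex to the identity shifts every vertex by one integer; as the weights
  -- add up to 1, the sum shifts by that integer and its class mod 1 is unchanged.
  have h : ∀ i, partialSum (barDiff (v ∘ enum ι)) ((enum ι).symm i) =
      ((v i).toAdd : ℝ) - ((v (enum ι 0)).toAdd : ℝ) := by
    intro i
    simp [partialSum, partialProd_barDiff, sub_eq_neg_add]
  simp only [h, mul_sub, Finset.sum_sub_distrib, ← Finset.sum_mul, stdSimplex.sum_eq_one, one_mul]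
  rw [AddCircle.coe_sub]
  have : (((v (enum ι 0)).toAdd : ℝ) : UnitAddCircle) = 0 :=
    (AddCircle.coe_eq_zero_iff 1).mpr ⟨(v (enum ι 0)).toAdd, by simp⟩
  rw [this, sub_zero]

end Point

/-! ### Continuity in homogeneous coordinates -/

section PointContinuity

variable {H : Type*} [Group H] [TopologicalSpace H] [CGGroup H] {X : Type*} [TopologicalSpace X]

/-- Multiplication is continuous only on the compactly generated product. On a compact set this
costs nothing, since a map that is continuous there remains so into the finer topology. -/
theorem continuousOn_mul_of_isCompact {K : Set X} (hK : IsCompact K) {f g : X → H}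
    (hf : ContinuousOn f K) (hg : ContinuousOn g K) : ContinuousOn (fun x => f x * g x) K :=
  (CGGroup.mul_continuous (G := H)).comp_continuousOn
    (f := fun x => CompactCoherentification.mk (H × H) (f x, g x))
    ((CompactCoherentification.continuousOn_rng_of_isCompact hK).mpr (hf.prodMk hg))

theorem continuous_map_barDiff (n : ℕ) : Continuous
    (CompactCoherentification.map (barDiff : (Fin (n + 1) → H) → (Fin n → H))) := by
  refine CompactCoherentification.continuous_map_of_continuousOn fun K hK => ?_
  refine continuousOn_pi.mpr fun j => continuousOn_mul_of_isCompact hK ?_ ?_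
  · exact (CGGroup.inv_continuous.comp (continuous_apply j.castSucc)).continuousOn
  · exact (continuous_apply j.succ).continuousOn

theorem continuous_map_partialProd (n : ℕ) : Continuous
    (CompactCoherentification.map (Fin.partialProd : (Fin n → H) → (Fin (n + 1) → H))) := by
  refine CompactCoherentification.continuous_map_of_continuousOn fun K hK => ?_
  refine continuousOn_pi.mpr fun i => ?_
  induction i using Fin.induction with
  | zero => simpa using continuousOn_const
  | succ i ih =>
    simp only [Fin.partialProd_succ]
    exact continuousOn_mul_of_isCompact hK ih (continuous_apply i).continuousOn

variable {ι : Type*} [Fintype ι] [LinearOrder ι] [Nonempty ι]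

theorem B.continuous_point {w : X → stdSimplex ℝ ι} {v : X → 𝐤 (ι → H)} (hw : Continuous w)
    (hv : Continuous v) :
    Continuous fun x => B.point (w x) ((CompactCoherentification.mk _).symm (v x)) := by
  have h : Continuous (CompactCoherentification.map fun u : ι → H => barDiff (u ∘ enum ι)) :=
    (continuous_map_barDiff _).comp (CompactCoherentification.continuous_map_of_continuous
      (f := fun u : ι → H => u ∘ enum ι) (by fun_prop))
  refine continuous_quot_mk.comp ?_
  exact (@continuous_sigmaMk ℕ (fun n : ℕ => stdSimplex ℝ (Fin (n + 1)) × 𝐤 (Fin n → H)) _ _).comp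
    (((stdSimplex.continuous_map _).comp hw).prodMk (h.comp hv))

end PointContinuity

/-! ### The common refinement of two subdivided intervals

A point of the simplex with vertices `ι` is a subdivision of `[0, 1]` into consecutive intervals
indexed by `ι`. The intersections of the intervals of two subdivisions form a common refinement,
indexed by `ι × κ`. -/

section Coupling

variable {ι κ κ' : Type*} [Fintype ι] [LinearOrder ι] [Fintype κ] [LinearOrder κ]
  [Fintype κ'] [LinearOrder κ']

/-- The left end of the interval with index `i`. -/
def lend (a : stdSimplex ℝ ι) (i : ι) : ℝ := ∑ j with j < i, a j

/-- The right end of the interval with index `i`. -/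
def rend (a : stdSimplex ℝ ι) (i : ι) : ℝ := ∑ j with j ≤ i, a j

theorem rend_eq (a : stdSimplex ℝ ι) (i : ι) : rend a i = lend a i + a i := by
  have h : (Finset.univ.filter fun j => j ≤ i) =
      insert i (Finset.univ.filter fun j => j < i) := by
    ext j; simp [le_iff_eq_or_lt]
  rw [rend, h, Finset.sum_insert (by simp), lend, add_comm]

theorem lend_nonneg (a : stdSimplex ℝ ι) (i : ι) : 0 ≤ lend a i :=
  Finset.sum_nonneg fun j _ => stdSimplex.zero_le a j

theorem lend_le_rend (a : stdSimplex ℝ ι) (i : ι) : lend a i ≤ rend a i := by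
  rw [rend_eq]; linarith [stdSimplex.zero_le a i]

theorem rend_nonneg (a : stdSimplex ℝ ι) (i : ι) : 0 ≤ rend a i :=
  (lend_nonneg a i).trans (lend_le_rend a i)

theorem rend_le_lend (a : stdSimplex ℝ ι) {i j : ι} (h : i < j) : rend a i ≤ lend a j := by
  refine Finset.sum_le_sum_of_subset_of_nonneg ?_ fun j _ _ => stdSimplex.zero_le a j
  intro k hk
  simp only [Finset.mem_filter, Finset.mem_univ, true_and] at hk ⊢
  exact hk.trans_lt h

theorem rend_le_one (a : stdSimplex ℝ ι) (i : ι) : rend a i ≤ 1 := by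
  rw [← stdSimplex.sum_eq_one a]
  exact Finset.sum_le_sum_of_subset_of_nonneg (Finset.filter_subset _ _)
    fun j _ _ => stdSimplex.zero_le a j

theorem lend_le_one (a : stdSimplex ℝ ι) (i : ι) : lend a i ≤ 1 :=
  (lend_le_rend a i).trans (rend_le_one a i)

theorem continuous_lend (i : ι) : Continuous fun a : stdSimplex ℝ ι => lend a i :=
  continuous_finsetSum _ fun j _ => (continuous_apply j).comp continuous_subtype_val

theorem continuous_rend (i : ι) : Continuous fun a : stdSimplex ℝ ι => rend a i :=
  continuous_finsetSum _ fun j _ => (continuous_apply j).comp continuous_subtype_val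

/-- The length of the intersection of the interval with index `i` with `[0, y]`. -/
def trunc (a : stdSimplex ℝ ι) (y : ℝ) (i : ι) : ℝ := min (rend a i) y - min (lend a i) y

/-- Adding the indices in increasing order telescopes: when the turn of `m` comes, everything below
it has been added, and that sum is the left end of the interval of `m`. -/
theorem sum_trunc_of_isLowerSet (a : stdSimplex ℝ ι) {y : ℝ} (hy : 0 ≤ y) (s : Finset ι)
    (hs : ∀ i ∈ s, ∀ j, j ≤ i → j ∈ s) : ∑ i ∈ s, trunc a y i = min (∑ i ∈ s, a i) y := by
  induction s using Finset.induction_on_max with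
  | empty => simp [hy]
  | insert m s hm ih =>
    have hms : m ∉ s := fun h => (hm m h).false
    have e1 : (Finset.univ.filter fun j => j < m) = s := by
      ext j
      simp only [Finset.mem_filter, Finset.mem_univ, true_and]
      refine ⟨fun h => ?_, hm j⟩
      exact (Finset.mem_insert.mp (hs m (Finset.mem_insert_self _ _) j h.le)).resolve_left h.ne
    have e2 : lend a m = ∑ i ∈ s, a i := by rw [lend, e1]
    rw [Finset.sum_insert hms, ih, Finset.sum_insert hms, trunc, rend_eq, e2, add_comm (a m)]
    · ring
    · intro i hi j hj
      exact (Finset.mem_insert.mp (hs i (Finset.mem_insert_of_mem hi) j hj)).resolve_left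
        (hj.trans_lt (hm i hi)).ne

theorem sum_trunc (a : stdSimplex ℝ ι) {y : ℝ} (hy : 0 ≤ y) (hy' : y ≤ 1) :
    ∑ i, trunc a y i = y := by
  rw [sum_trunc_of_isLowerSet a hy _ (by simp), stdSimplex.sum_eq_one, min_eq_right hy']

theorem trunc_map {ψ : κ → κ'} (hψ : Monotone ψ) (b : stdSimplex ℝ κ) {y : ℝ} (hy : 0 ≤ y)
    (k : κ') : trunc (stdSimplex.map ψ b) y k = ∑ j with ψ j = k, trunc b y j := by
  have e1 : rend (stdSimplex.map ψ b) k = ∑ j with ψ j ≤ k, b j := by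
    rw [rend]
    simp only [stdSimplex_map_apply]
    rw [Finset.sum_fiberwise_eq_sum_filter]
    simp
  have e2 : lend (stdSimplex.map ψ b) k = ∑ j with ψ j < k, b j := by
    rw [lend]
    simp only [stdSimplex_map_apply]
    rw [Finset.sum_fiberwise_eq_sum_filter]
    simp
  have h1 : ∀ (p : κ' → Prop) [DecidablePred p], (∀ i j, i ≤ j → p j → p i) →
      min (∑ j with p (ψ j), b j) y = ∑ j with p (ψ j), trunc b y j := by
    intro p _ hp
    refine (sum_trunc_of_isLowerSet b hy _ fun i hi j hj => ?_).symm
    simp only [Finset.mem_filter, Finset.mem_univ, true_and] at hi ⊢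
    exact hp _ _ (hψ hj) hi
  rw [trunc, e1, e2, h1 (· ≤ k) (fun i j h => h.trans), h1 (· < k) (fun i j h => h.trans_lt),
    sub_eq_iff_eq_add, ← Finset.sum_union]
  · refine Finset.sum_congr ?_ fun _ _ => rfl
    ext j; simp [le_iff_eq_or_lt]
  · refine Finset.disjoint_left.mpr fun j hj hj' => ?_
    simp only [Finset.mem_filter, Finset.mem_univ, true_and] at hj hj'
    exact hj'.ne hj

/-- The length of the intersection of two intervals of two subdivisions. -/
def overlap (a : stdSimplex ℝ ι) (b : stdSimplex ℝ κ) (i : ι) (j : κ) : ℝ :=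
  trunc b (rend a i) j - trunc b (lend a i) j

theorem overlap_comm (a : stdSimplex ℝ ι) (b : stdSimplex ℝ κ) (i : ι) (j : κ) :
    overlap a b i j = overlap b a j i := by
  simp only [overlap, trunc, min_comm (rend b j), min_comm (lend b j)]
  ring

theorem overlap_nonneg (a : stdSimplex ℝ ι) (b : stdSimplex ℝ κ) (i : ι) (j : κ) :
    0 ≤ overlap a b i j := by
  have h1 := lend_le_rend a i
  have h2 := lend_le_rend b j
  simp only [overlap, trunc, min_def]
  split_ifs <;> linarith

theorem sum_overlap_right (a : stdSimplex ℝ ι) (b : stdSimplex ℝ κ) (i : ι) :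
    ∑ j, overlap a b i j = a i := by
  simp only [overlap, Finset.sum_sub_distrib]
  rw [sum_trunc b (rend_nonneg a i) (rend_le_one a i),
    sum_trunc b (lend_nonneg a i) (lend_le_one a i), rend_eq]
  ring

theorem sum_overlap_left (a : stdSimplex ℝ ι) (b : stdSimplex ℝ κ) (j : κ) :
    ∑ i, overlap a b i j = b j := by
  simp only [overlap_comm a b]
  exact sum_overlap_right b a j

theorem lt_rend_of_overlap_ne_zero {a : stdSimplex ℝ ι} {b : stdSimplex ℝ κ} {i : ι} {j : κ}
    (h : overlap a b i j ≠ 0) : lend a i < rend b j := by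
  by_contra! h'
  apply h
  have h1 := lend_le_rend a i
  have h2 := lend_le_rend b j
  simp only [overlap, trunc]
  rw [min_eq_left h', min_eq_left (h'.trans h1), min_eq_left (h2.trans h'),
    min_eq_left ((h2.trans h').trans h1)]
  ring

/-- The pairs of overlapping intervals form a staircase. Otherwise the interval of `j`, lying to the
right of that of `j'`, would start before the interval of `i'` does, although the latter meets the
interval of `j'`. -/
theorem overlap_chain {a : stdSimplex ℝ ι} {b : stdSimplex ℝ κ} {i i' : ι} {j j' : κ}
    (h : overlap a b i j ≠ 0) (h' : overlap a b i' j' ≠ 0) (hi : i < i') : j ≤ j' := by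
  by_contra! hj
  rw [overlap_comm] at h
  have h1 := lt_rend_of_overlap_ne_zero h
  have h2 := lt_rend_of_overlap_ne_zero h'
  have h3 := rend_le_lend a hi
  have h4 := rend_le_lend b hj
  linarith

theorem overlap_map_right {ψ : κ → κ'} (hψ : Monotone ψ) (a : stdSimplex ℝ ι)
    (b : stdSimplex ℝ κ) (i : ι) (k : κ') :
    overlap a (stdSimplex.map ψ b) i k = ∑ j with ψ j = k, overlap a b i j := by
  simp only [overlap, Finset.sum_sub_distrib]
  rw [trunc_map hψ b (rend_nonneg a i), trunc_map hψ b (lend_nonneg a i)]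

/-- The common refinement of two subdivisions, in lexicographic order. -/
def coupling (a : stdSimplex ℝ ι) (b : stdSimplex ℝ κ) : stdSimplex ℝ (ι ×ₗ κ) :=
  ⟨fun p => overlap a b (ofLex p).1 (ofLex p).2, fun p => overlap_nonneg a b _ _, by
    rw [← toLex.sum_comp, Fintype.sum_prod_type]
    simp only [ofLex_toLex, sum_overlap_right, stdSimplex.sum_eq_one]⟩

theorem coupling_toLex (a : stdSimplex ℝ ι) (b : stdSimplex ℝ κ) (p : ι × κ) :
    coupling a b (toLex p) = overlap a b p.1 p.2 := rfl

theorem sum_coupling_mul (a : stdSimplex ℝ ι) (b : stdSimplex ℝ κ) (f : ι → ℝ) :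
    ∑ p, coupling a b p * f (ofLex p).1 = ∑ i, a i * f i := by
  rw [← toLex.sum_comp, Fintype.sum_prod_type]
  simp only [coupling_toLex, ofLex_toLex, ← Finset.sum_mul, sum_overlap_right]

theorem fst_ne_zero_of_coupling_ne_zero {a : stdSimplex ℝ ι} {b : stdSimplex ℝ κ} {p : ι ×ₗ κ}
    (h : coupling a b p ≠ 0) : a (ofLex p).1 ≠ 0 := by
  intro h0
  refine h (le_antisymm ?_ (stdSimplex.zero_le _ _))
  rw [← h0, ← sum_overlap_right a b]
  exact Finset.single_le_sum (f := fun j => overlap a b (ofLex p).1 j)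
    (fun j _ => overlap_nonneg a b _ j) (Finset.mem_univ _)

/-- The lexicographic order is only a convenient total order on the index set: on the support it is
compatible with both coordinates, by the staircase property. -/
theorem monotoneOn_snd_coupling (a : stdSimplex ℝ ι) (b : stdSimplex ℝ κ) :
    MonotoneOn (fun p : ι ×ₗ κ => (ofLex p).2) {p | coupling a b p ≠ 0} := by
  intro p hp q hq h
  rcases (Prod.Lex.le_iff.mp h) with h | ⟨_, h⟩
  · exact overlap_chain hp hq h
  · exact h

theorem map_snd_coupling (a : stdSimplex ℝ ι) (b : stdSimplex ℝ κ) :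
    stdSimplex.map (fun p : ι ×ₗ κ => (ofLex p).2) (coupling a b) = b := by
  ext k
  rw [stdSimplex_map_apply, ← sum_overlap_left a b k, Finset.sum_filter, ← toLex.sum_comp,
    Fintype.sum_prod_type]
  refine Finset.sum_congr rfl fun i _ => ?_
  rw [Finset.sum_eq_single k]
  · simp [coupling_toLex]
  · intro j _ hne
    simp [hne]
  · simp

theorem coupling_map_right {ψ : κ → κ'} (hψ : Monotone ψ) (a : stdSimplex ℝ ι)
    (b : stdSimplex ℝ κ) : coupling a (stdSimplex.map ψ b) =
      stdSimplex.map (fun p : ι ×ₗ κ => toLex ((ofLex p).1, ψ (ofLex p).2)) (coupling a b) := by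
  ext q
  obtain ⟨⟨i, k⟩, rfl⟩ := toLex.surjective q
  rw [stdSimplex_map_apply, coupling_toLex, overlap_map_right hψ, Finset.sum_filter,
    Finset.sum_filter, ← toLex.sum_comp, Fintype.sum_prod_type, Finset.sum_eq_single i]
  · simp [coupling_toLex]
  · intro i' _ hne
    simp [hne]
  · simp

theorem coupling_map_left {ψ : κ → κ'} (hψ : Monotone ψ) (a : stdSimplex ℝ κ)
    (b : stdSimplex ℝ ι) : coupling (stdSimplex.map ψ a) b =
      stdSimplex.map (fun p : κ ×ₗ ι => toLex (ψ (ofLex p).1, (ofLex p).2)) (coupling a b) := by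
  ext q
  obtain ⟨⟨i, k⟩, rfl⟩ := toLex.surjective q
  rw [stdSimplex_map_apply, coupling_toLex, overlap_comm, overlap_map_right hψ, Finset.sum_filter,
    Finset.sum_filter, ← toLex.sum_comp, Fintype.sum_prod_type_right, Finset.sum_eq_single k]
  · simp [coupling_toLex, overlap_comm a b]
  · intro i' _ hne
    simp [hne]
  · simp

theorem continuous_coupling :
    Continuous fun p : stdSimplex ℝ ι × stdSimplex ℝ κ => coupling p.1 p.2 := by
  refine Continuous.subtype_mk (continuous_pi fun q => ?_) _
  have h1 := (continuous_rend (ofLex q).1).comp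
    (continuous_fst (X := stdSimplex ℝ ι) (Y := stdSimplex ℝ κ))
  have h2 := (continuous_lend (ofLex q).1).comp
    (continuous_fst (X := stdSimplex ℝ ι) (Y := stdSimplex ℝ κ))
  have h3 := (continuous_rend (ofLex q).2).comp
    (continuous_snd (X := stdSimplex ℝ ι) (Y := stdSimplex ℝ κ))
  have h4 := (continuous_lend (ofLex q).2).comp
    (continuous_snd (X := stdSimplex ℝ ι) (Y := stdSimplex ℝ κ))
  exact ((h3.min h1).sub (h4.min h1)).sub ((h3.min h2).sub (h4.min h2))

end Coupling

/-! ### The homotopy equivalence `B(ℤ × G) → S¹ × BG` -/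

section Graft

variable {H : Type*} [Group H]
variable {ι ι' κ κ' : Type*} [Fintype ι] [LinearOrder ι] [Nonempty ι] [Fintype ι']
  [LinearOrder ι'] [Nonempty ι'] [Fintype κ] [LinearOrder κ] [Nonempty κ] [Fintype κ']
  [LinearOrder κ'] [Nonempty κ']

/-- The point of `BH` on the common refinement of two subdivisions. -/
def B.graft (a : stdSimplex ℝ ι) (t : stdSimplex ℝ κ) (v : ι → κ → H) : B H :=
  B.point (coupling a t) fun p => v (ofLex p).1 (ofLex p).2

theorem B.graft_congr {a : stdSimplex ℝ ι} (t : stdSimplex ℝ κ) {v v' : ι → κ → H}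
    (h : ∀ i, a i ≠ 0 → v i = v' i) : B.graft a t v = B.graft a t v' :=
  B.point_congr fun _ hp => congrFun (h _ (fst_ne_zero_of_coupling_ne_zero hp)) _

/-- If the labels do not depend on the first subdivision, refining by it has no effect. -/
theorem B.graft_const (a : stdSimplex ℝ ι) (t : stdSimplex ℝ κ) (v : κ → H) :
    B.graft a t (fun _ => v) = B.point t v := by
  have h := B.point_map_of_monotoneOn (monotoneOn_snd_coupling a t) v
  rw [map_snd_coupling] at h
  exact h.symm

theorem B.graft_map_right (ψ : κ →o κ') (a : stdSimplex ℝ ι) (t : stdSimplex ℝ κ)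
    (v : ι → κ' → H) :
    B.graft a (stdSimplex.map ψ t) v = B.graft a t (fun i j => v i (ψ j)) := by
  unfold B.graft
  rw [coupling_map_right ψ.monotone]
  refine B.point_map_of_monotoneOn (fun p _ q _ h => ?_) _
  rw [Prod.Lex.le_iff] at h ⊢
  exact h.imp id fun h => ⟨h.1, ψ.monotone h.2⟩

/-- When `ψ` identifies two first indices, the lexicographic order falls back on the second
coordinate. The reindexing is then monotone only on the support, where the staircase property
controls that coordinate. -/
theorem B.graft_map_left (ψ : ι →o ι') (a : stdSimplex ℝ ι) (t : stdSimplex ℝ κ)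
    (v : ι' → κ → H) :
    B.graft (stdSimplex.map ψ a) t v = B.graft a t (fun i j => v (ψ i) j) := by
  unfold B.graft
  rw [coupling_map_left ψ.monotone]
  refine B.point_map_of_monotoneOn (fun p hp q hq h => ?_) _
  have h2 := monotoneOn_snd_coupling a t hp hq h
  rw [Prod.Lex.le_iff] at h ⊢
  rcases h with h | h
  · rcases (ψ.monotone h.le).lt_or_eq with h' | h'
    · exact Or.inl h'
    · exact Or.inr ⟨h', h2⟩
  · exact Or.inr ⟨congrArg ψ h.1, h2⟩

theorem B.graft_mul_left (c : H) (a : stdSimplex ℝ ι) (t : stdSimplex ℝ κ) (v : ι → κ → H) :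
    B.graft a t (fun i j => c * v i j) = B.graft a t v :=
  B.point_mul_left c _ _

end Graft

/-! ### Replacing the ℤ-component of a point by a two-step function -/

section Deform

variable {G : Type*} [Group G]
variable {κ κ' : Type*} [Fintype κ] [LinearOrder κ] [Nonempty κ] [Fintype κ']
  [LinearOrder κ'] [Nonempty κ']

/-- The subdivision of `[0, 1]` with division points `min (1 - φ) τ` and `τ`. -/
def weights (τ φ : I) : stdSimplex ℝ (Fin 3) :=
  ⟨![min (1 - φ : ℝ) τ, τ - min (1 - φ : ℝ) τ, 1 - τ], by
    intro i
    fin_cases i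
    · exact le_min (sub_nonneg.mpr φ.2.2) τ.2.1
    · exact sub_nonneg.mpr (min_le_right _ _)
    · exact sub_nonneg.mpr τ.2.2, by
    simp [Fin.sum_univ_three]⟩

theorem continuous_weights : Continuous fun p : I × I => weights p.1 p.2 := by
  refine Continuous.subtype_mk (continuous_pi fun i => ?_) _
  fin_cases i
  · change Continuous fun p : I × I => min (1 - p.2 : ℝ) p.1
    fun_prop
  · change Continuous fun p : I × I => (p.1 : ℝ) - min (1 - p.2 : ℝ) p.1
    fun_prop
  · change Continuous fun p : I × I => 1 - (p.1 : ℝ)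
    fun_prop

theorem weights_one_apply (τ φ : I) : weights τ φ 1 = τ - min (1 - φ : ℝ) τ := rfl

theorem weights_two_apply (τ φ : I) : weights τ φ 2 = 1 - (τ : ℝ) := rfl

theorem weights_zero_right_apply (τ : I) : weights τ 0 1 = 0 := by
  have h : min (1 : ℝ) τ = τ := min_eq_right τ.2.2
  simp [weights_one_apply, h]

/-- The vertices of the deformation: first the vertices `(m, gⱼ)`, then `(m + 1, gⱼ)`, and finally
the given vertices `(kⱼ, gⱼ)`. -/
def deformVertex (m : ℤ) (v : κ → ZProd G) : Fin 3 → κ → ZProd G :=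
  ![fun j => (.ofAdd m, (v j).2), fun j => (.ofAdd (m + 1), (v j).2), v]

/-- The point that agrees with the point `(t, v)` on the interval `[τ, 1]`, and whose component in
`ℤ` on `[0, τ]` is replaced by `m` on `[0, 1 - φ]` and by `m + 1` on `[1 - φ, 1]`. -/
def deform (τ φ : I) (m : ℤ) (t : stdSimplex ℝ κ) (v : κ → ZProd G) : B (ZProd G) :=
  B.graft (weights τ φ) t (deformVertex m v)

/-- Together with `deform_mul_left` this lets constructions built from `deform` descend to the
classifying space: one handles the gluing relation, the other the choice of homogeneous coordinates.
-/
theorem deform_map (τ φ : I) (m : ℤ) (ψ : κ →o κ') (t : stdSimplex ℝ κ) (v : κ' → ZProd G) :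
    deform τ φ m (stdSimplex.map ψ t) v = deform τ φ m t (v ∘ ψ) := by
  unfold deform
  rw [B.graft_map_right]
  congr 1
  funext i j
  fin_cases i <;> rfl

theorem deform_mul_left (τ φ : I) (m : ℤ) (t : stdSimplex ℝ κ) (v : κ → ZProd G) (a : ℤ) (g : G) :
    deform τ φ (a + m) t (fun j => (.ofAdd a, g) * v j) = deform τ φ m t v := by
  have h : deformVertex (a + m) (fun j => ((.ofAdd a, g) : ZProd G) * v j) =
      fun i j => ((.ofAdd a, g) : ZProd G) * deformVertex m v i j := by
    funext i j
    fin_cases i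
    · rfl
    · exact Prod.ext (congrArg Multiplicative.ofAdd (add_assoc a m 1)) rfl
    · rfl
  unfold deform
  rw [h, B.graft_mul_left]

theorem deform_zero (φ : I) (m : ℤ) (t : stdSimplex ℝ κ) (v : κ → ZProd G) :
    deform 0 φ m t v = B.point t v := by
  rw [← B.graft_const (weights 0 φ)]
  refine B.graft_congr t fun i hi => ?_
  have h : min (1 - φ : ℝ) 0 = 0 := min_eq_right (sub_nonneg.mpr φ.2.2)
  fin_cases i
  · exact absurd h hi
  · exact absurd ((weights_one_apply 0 φ).trans (by simp [h])) hi
  · rfl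

theorem deform_one (φ : I) (m : ℤ) (t : stdSimplex ℝ κ) {v v' : κ → ZProd G}
    (h : ∀ j, (v j).2 = (v' j).2) : deform 1 φ m t v = deform 1 φ m t v' := by
  refine B.graft_congr t fun i hi => ?_
  fin_cases i
  · funext j; simp [deformVertex, h]
  · funext j; simp [deformVertex, h]
  · exact absurd ((weights_two_apply 1 φ).trans (by simp)) hi

/-- Both sides have the constant ℤ-component m + 1 on [0, τ]. This makes the deformation continuous
where the height crosses an integer, and closes the path of levels up to a circle. -/
theorem deform_succ (τ : I) (m : ℤ) (t : stdSimplex ℝ κ) (v : κ → ZProd G) :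
    deform τ 1 m t v = deform τ 0 (m + 1) t v := by
  -- The interval [0, τ] carries index 1 at φ = 1 and index 0 at φ = 0; merging the indices 0 and 1
  -- turns the second subdivision into the first.
  have h0 : weights τ 1 = stdSimplex.map (![1, 1, 2] : Fin 3 → Fin 3) (weights τ 0) := by
    ext i
    rw [stdSimplex_map_apply, Finset.sum_filter, Fin.sum_univ_three]
    have h1 : min (1 : ℝ) τ = τ := min_eq_right τ.2.2
    have h2 : min (0 : ℝ) τ = 0 := min_eq_left τ.2.1
    change (![min (1 - 1 : ℝ) τ, τ - min (1 - 1 : ℝ) τ, 1 - τ] : Fin 3 → ℝ) i =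
      (if (1 : Fin 3) = i then min (1 - 0 : ℝ) τ else 0) +
      (if (1 : Fin 3) = i then τ - min (1 - 0 : ℝ) τ else 0) +
      (if (2 : Fin 3) = i then 1 - (τ : ℝ) else 0)
    fin_cases i <;> simp [h1, h2]
  unfold deform
  rw [h0]
  refine (B.graft_map_left ⟨![1, 1, 2], by decide⟩ (weights τ 0) t _).trans ?_
  refine B.graft_congr t fun i hi => ?_
  fin_cases i
  · rfl
  · exact absurd (weights_zero_right_apply τ) hi
  · rfl

theorem deform_const (τ φ : I) (hφ : φ = 0) (t : stdSimplex ℝ κ) :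
    deform τ φ 0 t (1 : κ → ZProd G) = B.base (ZProd G) := by
  subst hφ
  rw [← B.point_const t (1 : ZProd G), ← B.graft_const (weights τ 0) t]
  refine B.graft_congr t fun i hi => ?_
  fin_cases i
  · rfl
  · exact absurd (weights_zero_right_apply τ) hi
  · rfl

variable [TopologicalSpace G]

theorem compare_point (t : stdSimplex ℝ κ) (v : κ → ZProd G) :
    B.compare G (B.point t v) =
      (((∑ j, t j * ((v j).1.toAdd : ℝ) : ℝ) : UnitAddCircle), B.point t fun j => (v j).2) := by
  refine Prod.ext ?_ (B.map_point (ContinuousMonoidHom.snd (Multiplicative ℤ) G) t v)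
  exact (congrArg B.toCircle (B.map_point (ContinuousMonoidHom.fst (Multiplicative ℤ) G) t v)).trans
    (B.toCircle_point t _)

theorem compare_deform (φ : I) (t : stdSimplex ℝ κ) (g : κ → G) :
    B.compare G (deform 1 φ 0 t fun j => (1, g j)) = (((φ : ℝ) : UnitAddCircle), B.point t g) := by
  unfold deform B.graft
  rw [compare_point]
  have h1 : ∑ p, coupling (weights 1 φ) t p * (((deformVertex 0 (fun j => (1, g j))
      (ofLex p).1 (ofLex p).2 : ZProd G).1.toAdd : ℤ) : ℝ) = φ := by
    -- Only the vertices of the middle block have ℤ-component 1, and the block has total weight 1 -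
    -- min (1 - φ) 1 = φ.
    have h := sum_coupling_mul (weights 1 φ) t ![0, 1, 0]
    refine Eq.trans (Finset.sum_congr rfl fun p _ => congrArg _ ?_) (h.trans ?_)
    · obtain ⟨⟨i, j⟩, rfl⟩ := toLex.surjective p
      fin_cases i <;> simp [deformVertex]
    · have : min (1 - φ : ℝ) 1 = 1 - φ := min_eq_left (by linarith [φ.2.1])
      simp [Fin.sum_univ_three, weights_one_apply, this]
  rw [h1, ← B.graft_const (weights 1 φ) t g]
  refine congrArg (fun y => (((φ : ℝ) : UnitAddCircle), B.point (coupling (weights 1 φ) t) y)) ?_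
  funext p
  obtain ⟨⟨i, j⟩, rfl⟩ := toLex.surjective p
  fin_cases i <;> rfl

variable [CGGroup G]

theorem continuous_deform {X : Type*} [TopologicalSpace X] {τ φ : X → I} {t : X → stdSimplex ℝ κ}
    {v : X → 𝐤 (κ → ZProd G)} (hτ : Continuous τ) (hφ : Continuous φ) (m : ℤ) (ht : Continuous t)
    (hv : Continuous v) : Continuous fun x =>
      deform (τ x) (φ x) m (t x) ((CompactCoherentification.mk _).symm (v x)) := by
  have h1 : Continuous (CompactCoherentification.map fun (v : κ → ZProd G)
      (p : Fin 3 ×ₗ κ) => deformVertex m v (ofLex p).1 (ofLex p).2) := by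
    refine CompactCoherentification.continuous_map_of_continuous (continuous_pi fun p => ?_)
    obtain ⟨⟨i, j⟩, rfl⟩ := toLex.surjective p
    fin_cases i
    · exact continuous_const.prodMk (continuous_snd.comp (continuous_apply j))
    · exact continuous_const.prodMk (continuous_snd.comp (continuous_apply j))
    · exact continuous_apply j
  exact B.continuous_point
    (continuous_coupling.comp ((continuous_weights.comp (hτ.prodMk hφ)).prodMk ht))
    (h1.comp hv)

end Deform

/-! ### Maps on S¹ × W from maps on [0, 1] × W with equal ends -/

section CircleGlue

variable {W Z : Type*} [TopologicalSpace W] [TopologicalSpace Z]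

/-- A product of proper maps is proper, hence closed; so the quotient property survives the product
with an arbitrary space `W`. -/
theorem isQuotientMap_circle_prod (W : Type*) [TopologicalSpace W] : Topology.IsQuotientMap
    (Prod.map (fun s : I => ((s : ℝ) : UnitAddCircle)) (id : W → W)) :=
  (OmegaSpectrum.isProperMap_circle.prodMap isProperMap_id).isClosedMap.isQuotientMap
    (OmegaSpectrum.isProperMap_circle.prodMap isProperMap_id).continuous
    (OmegaSpectrum.surjective_circle.prodMap Function.surjective_id)

/-- The loops of a map `[0, 1] × W → Z` that agrees on both ends. -/
def gluePath (L : C(I × W, Z)) (h : ∀ w, L (0, w) = L (1, w)) (w : W) :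
    Path (L (0, w)) (L (0, w)) where
  toFun s := L (s, w)
  continuous_toFun := by fun_prop
  source' := rfl
  target' := (h w).symm

/-- A map `[0, 1] × W → Z` that agrees on both ends, as a map on `S¹ × W`. -/
def circleGlue (L : C(I × W, Z)) (h : ∀ w, L (0, w) = L (1, w)) : C(UnitAddCircle × W, Z) where
  toFun p := OmegaSpectrum.circleEval (gluePath L h p.2) p.1
  continuous_toFun := by
    rw [(isQuotientMap_circle_prod W).continuous_iff]
    exact L.continuous.congr fun p =>
      (OmegaSpectrum.circleEval_coe (gluePath L h p.2) p.1).symm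

theorem circleGlue_coe (L : C(I × W, Z)) (h : ∀ w, L (0, w) = L (1, w)) (s : I) (w : W) :
    circleGlue L h (((s : ℝ) : UnitAddCircle), w) = L (s, w) :=
  OmegaSpectrum.circleEval_coe (gluePath L h w) s

theorem circleGlue_zero (L : C(I × W, Z)) (h : ∀ w, L (0, w) = L (1, w)) (w : W) :
    circleGlue L h (0, w) = L (0, w) :=
  circleGlue_coe L h 0 w

end CircleGlue

/-! ### The height: the integral of the ℤ-component -/

section Height

variable {G : Type*} {κ κ' : Type*} [Fintype κ] [Fintype κ']

/-- The real number `∑ tⱼ kⱼ`. -/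
def height (t : stdSimplex ℝ κ) (v : κ → ZProd G) : ℝ := ∑ j, t j * ((v j).1.toAdd : ℝ)

theorem height_map (ψ : κ → κ') (t : stdSimplex ℝ κ) (v : κ' → ZProd G) :
    height (stdSimplex.map ψ t) v = height t (v ∘ ψ) :=
  sum_stdSimplex_map_mul ψ t fun j => ((v j).1.toAdd : ℝ)

theorem height_mul_left [Group G] (t : stdSimplex ℝ κ) (v : κ → ZProd G) (c : ZProd G) :
    height t (fun j => c * v j) = (c.1.toAdd : ℤ) + height t v := by
  simp [height, mul_add, Finset.sum_add_distrib, ← Finset.sum_mul, stdSimplex.sum_eq_one]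

theorem continuous_height [TopologicalSpace G] {X : Type*} [TopologicalSpace X]
    {t : X → stdSimplex ℝ κ} {v : X → 𝐤 (κ → ZProd G)}
    (ht : Continuous t)
    (hv : Continuous v) :
    Continuous fun x => height (t x) ((CompactCoherentification.mk _).symm (v x)) := by
  refine continuous_finsetSum _ fun j _ => Continuous.mul ?_ ?_
  · exact (continuous_apply j).comp (continuous_subtype_val.comp ht)
  · have h1 : Continuous fun k : Multiplicative ℤ => (k.toAdd : ℝ) := continuous_of_discreteTopology
    exact h1.comp (continuous_fst.comp ((continuous_apply j).comp
      (CompactCoherentification.continuous_mk_symm.comp hv)))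

end Height

/-! ### Straightening a point to the two-step function of the same height -/

section Shear

variable {G : Type*} [Group G]
variable {κ κ' : Type*} [Fintype κ] [LinearOrder κ] [Nonempty κ] [Fintype κ']
  [LinearOrder κ'] [Nonempty κ']

/-- The fractional part of a real number, as a point of the unit interval. -/
def fractI (r : ℝ) : I := ⟨Int.fract r, Int.fract_nonneg r, (Int.fract_lt_one r).le⟩

/-- The straightening at time `τ` of the component in `ℤ` of the point `(t, v)`. -/
def shear (τ : I) (t : stdSimplex ℝ κ) (v : κ → ZProd G) : B (ZProd G) :=
  deform τ (fractI (height t v)) ⌊height t v⌋ t v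

theorem shear_map (τ : I) (ψ : κ →o κ') (t : stdSimplex ℝ κ) (v : κ' → ZProd G) :
    shear τ (stdSimplex.map ψ t) v = shear τ t (v ∘ ψ) := by
  unfold shear
  rw [deform_map, height_map]

/-- Translation by an integer keeps the fractional part of the height and shifts its floor by the
same integer as the vertices. -/
theorem shear_mul_left (τ : I) (t : stdSimplex ℝ κ) (v : κ → ZProd G) (c : ZProd G) :
    shear τ t (fun j => c * v j) = shear τ t v := by
  unfold shear
  have h : fractI ((c.1.toAdd : ℤ) + height t v) = fractI (height t v) :=
    Subtype.ext (Int.fract_intCast_add _ _)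
  rw [height_mul_left, h, Int.floor_intCast_add]
  exact deform_mul_left τ _ _ t v c.1.toAdd c.2

theorem deform_one_eq (φ : I) (m : ℤ) (t : stdSimplex ℝ κ) (v : κ → ZProd G) :
    deform 1 φ m t v = deform 1 φ 0 t fun j => (1, (v j).2) := by
  rw [← deform_mul_left 1 φ 0 t (fun j => (1, (v j).2)) m 1, add_zero]
  exact deform_one φ m t fun j => (one_mul _).symm

theorem shear_one (t : stdSimplex ℝ κ) (v : κ → ZProd G) :
    shear 1 t v = deform 1 (fractI (height t v)) 0 t fun j => (1, (v j).2) :=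
  deform_one_eq _ _ t v

theorem shear_const_one (τ : I) (t : stdSimplex ℝ κ) :
    shear τ t (1 : κ → ZProd G) = B.base (ZProd G) := by
  have h : height t (1 : κ → ZProd G) = 0 := by simp [height]
  unfold shear
  rw [h, Int.floor_zero]
  exact deform_const τ _ (Subtype.ext Int.fract_zero) t

variable [TopologicalSpace G] [CGGroup G] {X : Type*} [TopologicalSpace X]

/-- Floor and fractional part jump at integers, so continuity is checked on the locally finite
closed cover by the sets where the height lies in [m, m + 1]. There the map is the deformation with
`m` fixed and φ the height minus m. -/
theorem continuous_shear {τ : X → I} {t : X → stdSimplex ℝ κ}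
    {v : X → 𝐤 (κ → ZProd G)} (hτ : Continuous τ) (ht : Continuous t) (hv : Continuous v) :
    Continuous fun x => shear (τ x) (t x) ((CompactCoherentification.mk _).symm (v x)) := by
  have hu := continuous_height ht hv
  set u : X → ℝ := fun x => height (t x) ((CompactCoherentification.mk _).symm (v x)) with hu'
  have hlf : LocallyFinite fun m : ℤ => Set.Icc (m : ℝ) (m + 1) := by
    intro x
    refine ⟨Set.Ioo (x - 1) (x + 1), Ioo_mem_nhds (by linarith) (by linarith), ?_⟩
    refine (Set.finite_Icc (⌊x⌋ - 3) (⌊x⌋ + 3)).subset ?_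
    rintro m ⟨y, ⟨h1, h2⟩, h3, h4⟩
    have h5 := Int.floor_le x
    have h6 := Int.lt_floor_add_one x
    constructor
    · have : ((⌊x⌋ - 3 : ℤ) : ℝ) ≤ m := by push_cast; linarith
      exact_mod_cast this
    · have : (m : ℝ) ≤ ((⌊x⌋ + 3 : ℤ) : ℝ) := by push_cast; linarith
      exact_mod_cast this
  refine (hlf.preimage_continuous hu).continuous ?_ (fun m => isClosed_Icc.preimage hu) fun m => ?_
  · refine Set.eq_univ_of_forall fun x => Set.mem_iUnion.mpr ⟨⌊u x⌋, Int.floor_le _, ?_⟩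
    exact (Int.lt_floor_add_one _).le
  · have h := continuous_deform (φ := fun x => Set.projIcc 0 1 zero_le_one (u x - m)) hτ
      (continuous_projIcc.comp (by fun_prop)) m ht hv
    refine h.continuousOn.congr fun x hx => ?_
    change deform (τ x) (fractI (u x)) ⌊u x⌋ _ _ = _
    rcases hx.2.lt_or_eq with hlt | heq
    · have hfl : ⌊u x⌋ = m := Int.floor_eq_iff.mpr ⟨hx.1, hlt⟩
      have hfr : fractI (u x) = Set.projIcc 0 1 zero_le_one (u x - m) := by
        rw [Set.projIcc_of_mem zero_le_one ⟨sub_nonneg.mpr hx.1, by linarith⟩]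
        exact Subtype.ext (congrArg (fun k : ℤ => u x - k) hfl)
      rw [hfl, hfr]
    -- At the right end the floor is already m + 1 with φ = 0, while the formula for `m` has φ = 1;
    -- `deform_succ` identifies the two.
    · have hfl : ⌊u x⌋ = m + 1 := by rw [heq]; exact_mod_cast Int.floor_intCast (m + 1)
      have hfr : fractI (u x) = 0 := by
        refine Subtype.ext ?_
        change Int.fract (u x) = 0
        rw [Int.fract, hfl, heq]; push_cast; ring
      have hpr : Set.projIcc (0 : ℝ) 1 zero_le_one (u x - m) = 1 := by
        rw [heq, add_sub_cancel_left, Set.projIcc_right]; rfl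
      dsimp only
      rw [hfl, hfr, hpr, deform_succ]

end Shear

/-! ### The homotopy inverse of the comparison map -/

section Equivalence

/-- The product of a quotient map with a locally compact space is again a quotient map, so
continuity can be tested cell by cell in the ordinary product topology. -/
theorem B.continuous_of_prod {H : Type*} [Group H] [TopologicalSpace H] {W Z : Type*}
    [TopologicalSpace W] [LocallyCompactSpace W] [TopologicalSpace Z] {f : W × B H → Z}
    (h : ∀ n, Continuous fun p : W × (stdSimplex ℝ (Fin (n + 1)) × 𝐤 (Fin n → H)) =>
      f (p.1, Quot.mk _ ⟨n, p.2⟩)) : Continuous f := by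
  have hq : Topology.IsQuotientMap (Quot.mk (BarRel (G := H))) := isQuotientMap_quot_mk
  refine hq.continuous_lift_prod_right ?_
  have h' : Continuous fun q : (Σ n : ℕ, (stdSimplex ℝ (Fin (n + 1)) × 𝐤 (Fin n → H)) × W) =>
      f (q.2.2, Quot.mk _ ⟨q.1, q.2.1⟩) :=
    continuous_sigma fun n => (h n).comp continuous_swap
  exact h'.comp (Homeomorph.sigmaProdDistrib.continuous.comp continuous_swap)

variable (G : Type*) [Group G]

/-- The section at height `φ` of the projection `B(ℤ × G) → BG`. -/
def B.level (φ : I) : B G → B (ZProd G) :=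
  Quot.lift (fun p => deform 1 φ 0 p.2.1 fun j =>
    (1, Fin.partialProd ((CompactCoherentification.mk _).symm p.2.2) j)) (by
    rintro _ _ ⟨θ, t, x⟩
    rename_i m n
    change deform 1 φ 0 (stdSimplex.map θ t) (fun j => (1, Fin.partialProd x j)) =
      deform 1 φ 0 t (fun j => (1, Fin.partialProd (barOp θ x) j))
    rw [deform_map, ← deform_mul_left 1 φ 0 t ((fun j => (1, Fin.partialProd x j)) ∘ θ) 0
      (Fin.partialProd x (θ 0))⁻¹, add_zero]
    refine congrArg _ (funext fun j => Prod.ext rfl ?_)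
    rw [partialProd_barOp]
    rfl)

variable {G}

theorem B.level_point (φ : I) {n : ℕ} (t : stdSimplex ℝ (Fin (n + 1))) (g : Fin (n + 1) → G) :
    B.level G φ (B.point t g) = deform 1 φ 0 t fun j => (1, g j) := by
  rw [B.point_fin]
  change deform 1 φ 0 t (fun j => (1, Fin.partialProd (barDiff g) j)) = _
  rw [← deform_mul_left 1 φ 0 t (fun j => (1, g j)) 0 (g 0)⁻¹, add_zero]
  refine congrArg _ (funext fun j => Prod.ext rfl ?_)
  rw [partialProd_barDiff]
  rfl

variable (G)

theorem B.level_zero_eq_one (y : B G) : B.level G 0 y = B.level G 1 y := by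
  obtain ⟨n, t, g, rfl⟩ := B.exists_point y
  rw [B.level_point, B.level_point, deform_succ, deform_one_eq 0 (0 + 1)]

variable [TopologicalSpace G] [CGGroup G]

theorem B.continuous_level : Continuous fun p : I × B G => B.level G p.1 p.2 := by
  refine B.continuous_of_prod fun n => ?_
  have h : Continuous (CompactCoherentification.map fun (x : Fin n → G) (j : Fin (n + 1)) =>
      ((1, Fin.partialProd x j) : ZProd G)) :=
    (CompactCoherentification.continuous_map_of_continuous
      (f := fun (v : Fin (n + 1) → G) (j : Fin (n + 1)) => ((1, v j) : ZProd G))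
      (by fun_prop)).comp (continuous_map_partialProd n)
  exact continuous_deform continuous_const continuous_fst 0 (continuous_fst.comp continuous_snd)
    (h.comp (continuous_snd.comp continuous_snd))

/-- The homotopy inverse `S¹ × BG → B(ℤ × G)` of the comparison map. -/
def B.uncompare : C(UnitAddCircle × B G, B (ZProd G)) :=
  circleGlue ⟨fun p => B.level G p.1 p.2, B.continuous_level G⟩ fun y => B.level_zero_eq_one G y

theorem B.compare_uncompare : (B.compare G).comp (B.uncompare G) = ContinuousMap.id _ := by
  ext1 p
  obtain ⟨s, y⟩ := p
  obtain ⟨s, rfl⟩ := OmegaSpectrum.surjective_circle s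
  obtain ⟨n, t, g, rfl⟩ := B.exists_point y
  change B.compare G (B.uncompare G (((s : ℝ) : UnitAddCircle), _)) = _
  rw [B.uncompare, circleGlue_coe]
  refine (congrArg (B.compare G) (B.level_point s t g)).trans ?_
  rw [compare_deform]
  rfl

/-- At τ = 1 and φ = 0 the first block has weight 1, so only the vertices (0, gⱼ) survive. -/
theorem B.uncompare_zero (y : B G) :
    B.uncompare G (0, y) = B.map (ContinuousMonoidHom.inr (Multiplicative ℤ) G) y := by
  rw [B.uncompare, circleGlue_zero]
  change B.level G 0 y = _
  obtain ⟨n, t, g, rfl⟩ := B.exists_point y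
  rw [B.level_point, B.map_point]
  unfold deform
  rw [← B.graft_const (weights 1 0) t]
  refine B.graft_congr t fun i hi => ?_
  fin_cases i
  · rfl
  · exact absurd (weights_zero_right_apply 1) hi
  · rfl

theorem B.uncompare_base : B.uncompare G (0, B.base G) = B.base (ZProd G) := by
  rw [B.uncompare_zero, B.map_base]

/-- The homotopy from the identity of `B(ℤ × G)` to the retraction onto `S¹ × BG`. -/
def B.shearHomotopy : C(I × B (ZProd G), B (ZProd G)) where
  toFun p := Quot.lift (fun q : BarPoint (ZProd G) =>
      shear p.1 q.2.1 (Fin.partialProd ((CompactCoherentification.mk _).symm q.2.2))) (by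
    rintro _ _ ⟨θ, t, x⟩
    rename_i m n
    change shear p.1 (stdSimplex.map θ t) (Fin.partialProd x) =
      shear p.1 t (Fin.partialProd (barOp θ x))
    rw [shear_map, ← shear_mul_left p.1 t (Fin.partialProd x ∘ θ) (Fin.partialProd x (θ 0))⁻¹]
    exact congrArg _ (funext fun j => (partialProd_barOp θ x j).symm)) p.2
  continuous_toFun := by
    refine B.continuous_of_prod fun n => ?_
    exact continuous_shear continuous_fst (continuous_fst.comp continuous_snd)
      ((continuous_map_partialProd n).comp (continuous_snd.comp continuous_snd))

theorem B.shearHomotopy_point (τ : I) {n : ℕ} (t : stdSimplex ℝ (Fin (n + 1)))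
    (v : Fin (n + 1) → ZProd G) : B.shearHomotopy G (τ, B.point t v) = shear τ t v := by
  rw [B.point_fin]
  change shear τ t (Fin.partialProd (barDiff v)) = _
  rw [← shear_mul_left τ t v (v 0)⁻¹]
  exact congrArg _ (funext fun j => partialProd_barDiff v j)

/-- The straightening at time 1 depends only on the G-component and the height mod 1, which is what
the comparison map records. The basepoint has height 0 and all vertices trivial, so it stays fixed
throughout. -/
theorem B.uncompare_compare : ((B.uncompare G).comp (B.compare G)).HomotopicRel
    (ContinuousMap.id (B (ZProd G))) {B.base (ZProd G)} := by
  refine ContinuousMap.HomotopicRel.symm ⟨⟨⟨B.shearHomotopy G, fun y => ?_, fun y => ?_⟩, ?_⟩⟩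
  · obtain ⟨n, t, v, rfl⟩ := B.exists_point y
    exact (B.shearHomotopy_point G 0 t v).trans (deform_zero _ _ t v)
  · obtain ⟨n, t, v, rfl⟩ := B.exists_point y
    change B.shearHomotopy G (1, B.point t v) = B.uncompare G (B.compare G (B.point t v))
    rw [B.shearHomotopy_point, compare_point, shear_one]
    have h : ((height t v : ℝ) : UnitAddCircle) =
        (((fractI (height t v) : I) : ℝ) : UnitAddCircle) := by
      conv_lhs => rw [← Int.floor_add_fract (height t v), AddCircle.coe_add]
      have : (((⌊height t v⌋ : ℤ) : ℝ) : UnitAddCircle) = 0 :=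
        (AddCircle.coe_eq_zero_iff 1).mpr ⟨⌊height t v⌋, by simp⟩
      rw [this, zero_add]
      rfl
    change _ = B.uncompare G (((height t v : ℝ) : UnitAddCircle), _)
    rw [h, B.uncompare, circleGlue_coe]
    exact (B.level_point _ t _).symm
  · rintro τ _ rfl
    have h : B.base (ZProd G) =
        B.point (stdSimplex.vertex 0 : stdSimplex ℝ (Fin 1)) (1 : Fin 1 → ZProd G) :=
      (B.point_const _ 1).symm
    change B.shearHomotopy G (τ, B.base (ZProd G)) = B.base (ZProd G)
    conv_lhs => rw [h, B.shearHomotopy_point]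
    exact shear_const_one τ _

end Equivalence

/-! ### Cohomology of the product with a circle -/

section PairClassLemmas

variable {X X' X'' Y Z : Type*} [TopologicalSpace X] [TopologicalSpace X'] [TopologicalSpace X'']
  [TopologicalSpace Y] [TopologicalSpace Z]

theorem PairClass.pull_pull {A : Set X} {A' : Set X'} {A'' : Set X''} {y : Y} (f : C(X, X'))
    (hf : Set.MapsTo f A A') (g : C(X', X'')) (hg : Set.MapsTo g A' A'') (c : PairClass A'' y) :
    pull f hf (pull g hg c) = pull (g.comp f) (hg.comp hf) c := by
  induction c using Quotient.inductionOn with | _ c => rfl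

theorem PairClass.pull_congr {A : Set X} {A' : Set X'} {y : Y} {f g : C(X, X')}
    (hf : Set.MapsTo f A A') (h : f = g) (c : PairClass A' y) :
    pull f hf c = pull g (h ▸ hf) c := by
  subst h; rfl

theorem PairClass.pull_of_homotopic_id {A : Set X} {y : Y} {f : C(X, X)} (hf : Set.MapsTo f A A)
    (h : f.HomotopicRel (ContinuousMap.id X) A) (c : PairClass A y) : pull f hf c = c := by
  obtain ⟨H⟩ := h
  induction c using Quotient.inductionOn with | _ c =>
  refine PairClass.sound (c.1.comp H.toContinuousMap) ?_ ?_ ?_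
  · intro x; exact congrArg c.1 (H.apply_zero x)
  · intro x; exact congrArg c.1 (H.apply_one x)
  · intro t a ha
    exact (congrArg c.1 (H.eq_snd t ha)).trans (c.2 a ha)

theorem PairClass.exact {A : Set X} {y : Y} {f g : PairMap A y}
    (h : PairClass.mk f = PairClass.mk g) : f.1.HomotopicRel g.1 A :=
  Quotient.exact h

end PairClassLemmas

/-! ### Families of loops as maps on S¹ × Y -/

section Circle

open OmegaSpectrum

variable {W Y Y' Z Z' : Type*} [TopologicalSpace W] [TopologicalSpace Y] [TopologicalSpace Y']
  [TopologicalSpace Z] [TopologicalSpace Z']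

theorem circleEval_loopMap {z : Z} {z' : Z'} (φ : C(Z, Z')) (hφ : φ z = z') (γ : Path z z)
    (s : UnitAddCircle) : circleEval (loopMap φ hφ γ) s = φ (circleEval γ s) := by
  obtain ⟨s, rfl⟩ := surjective_circle s
  exact (circleEval_coe _ s).trans (congrArg φ (circleEval_coe γ s).symm)

theorem push_uncurryLoop {z : Z} {z' : Z'} (φ : C(Z, Z')) (hφ : φ z = z')
    (c : PairClass (∅ : Set Y) (Path.refl z)) :
    PairClass.push φ hφ (uncurryLoop c) =
      uncurryLoop (PairClass.push (loopMap φ hφ) (loopMap_refl φ hφ) c) := by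
  induction c using Quotient.inductionOn with | _ c =>
  refine congrArg PairClass.mk (Subtype.ext (ContinuousMap.ext fun p => ?_))
  exact (circleEval_loopMap φ hφ (c.1 p.2) p.1).symm

theorem mapsTo_id_prodMap (f : C(Y, Y')) :
    Set.MapsTo ((ContinuousMap.id UnitAddCircle).prodMap f) {p | p.1 = 0} {p | p.1 = 0} :=
  fun _ h => h

theorem pull_uncurryLoop {z : Z} (f : C(Y, Y')) (c : PairClass (∅ : Set Y') (Path.refl z)) :
    PairClass.pull ((ContinuousMap.id UnitAddCircle).prodMap f) (mapsTo_id_prodMap f)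
      (uncurryLoop c) =
      uncurryLoop (PairClass.pull f (Set.mapsTo_empty f _) c) := by
  induction c using Quotient.inductionOn with | _ c => rfl

theorem surjective_uncurryLoop (z : Z) : Function.Surjective (uncurryLoop (Y := Y) (z := z)) := by
  intro x
  induction x using Quotient.inductionOn with | _ f =>
  have h1 : (((1 : I) : ℝ) : UnitAddCircle) = 0 := AddCircle.coe_period 1
  let c : Y → Path z z := fun y =>
    { toFun := fun s => f.1 (((s : ℝ) : UnitAddCircle), y)
      continuous_toFun := f.1.continuous.comp
        (((AddCircle.continuous_mk' 1).comp continuous_subtype_val).prodMk continuous_const)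
      source' := f.2 _ rfl
      target' := f.2 _ h1 }
  have hc : Continuous c := by
    rw [← Path.continuous_uncurry_iff]
    exact f.1.continuous.comp (((AddCircle.continuous_mk' 1).comp
      (continuous_subtype_val.comp continuous_snd)).prodMk continuous_fst)
  refine ⟨PairClass.mk ⟨⟨c, hc⟩, fun _ h => h.elim⟩, ?_⟩
  refine congrArg PairClass.mk (Subtype.ext (ContinuousMap.ext fun p => ?_))
  obtain ⟨s, y⟩ := p
  obtain ⟨s, rfl⟩ := surjective_circle s
  exact circleEval_coe (c y) s

/-- Eckmann–Hilton: concatenation in the inner and in the outer loop coordinate give the same sum.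
-/
theorem double_loop_add_eq {X : Type*} [TopologicalSpace X] {A : Set X} {z : Z}
    (a b : PairClass A (Path.refl (Path.refl z))) :
    PairClass.push (loopSwap z) (loopSwap_refl z)
      (PairClass.push (loopSwap z) (loopSwap_refl z) a +
        PairClass.push (loopSwap z) (loopSwap_refl z) b) = a + b := by
  let T : PairClass A (Path.refl (Path.refl z)) → PairClass A (Path.refl (Path.refl z)) :=
    PairClass.push (loopSwap z) (loopSwap_refl z)
  have hT : ∀ a, T (T a) = a := PairClass.push_loopSwap
  have h0 : T 0 = 0 := rfl
  have h := EckmannHilton.mul (m₁ := fun a b => T (T a + T b)) (m₂ := fun a b => a + b)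
    (e₁ := 0) (e₂ := 0)
    { left_id := fun a => by simp [h0, hT], right_id := fun a => by simp [h0, hT] }
    { left_id := zero_add, right_id := add_zero }
    (fun a b c d => (PairClass.interchange a c b d).symm)
  exact congrFun (congrFun h a) b

/-- Uncurrying absorbs the outer loop coordinate into the circle, so the sum on the right
concatenates the inner one. The source sum is therefore first moved to the inner coordinate. -/
theorem uncurryLoop_loop_add {z : Z} (a b : PairClass (∅ : Set Y) (Path.refl (Path.refl z))) :
    uncurryLoop (a + b) = uncurryLoop a + uncurryLoop b := by
  rw [← double_loop_add_eq]
  induction a using Quotient.inductionOn with | _ a =>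
  induction b using Quotient.inductionOn with | _ b =>
  refine congrArg PairClass.mk (Subtype.ext (ContinuousMap.ext fun p => ?_))
  obtain ⟨s, y⟩ := p
  obtain ⟨s, rfl⟩ := surjective_circle s
  change circleEval (loopSwap z ((loopSwap z (a.1 y)).trans (loopSwap z (b.1 y))))
    ((s : ℝ) : UnitAddCircle) = (circleEval (a.1 y) ((s : ℝ) : UnitAddCircle)).trans
    (circleEval (b.1 y) ((s : ℝ) : UnitAddCircle))
  rw [circleEval_coe, circleEval_coe, circleEval_coe]
  ext u
  change (Path.trans (loopSwap z (a.1 y)) (loopSwap z (b.1 y))) u s = _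
  simp only [Path.trans_apply]
  split_ifs <;> rfl

theorem coe_projIcc_eq_zero {r : ℝ} (h : r ≤ 0 ∨ 1 ≤ r) :
    (((Set.projIcc (0 : ℝ) 1 zero_le_one r : I) : ℝ) : UnitAddCircle) = 0 := by
  rcases h with h | h
  · rw [Set.projIcc_of_le_left _ h]; rfl
  · rw [Set.projIcc_of_right_le _ h]; exact AddCircle.coe_period 1

theorem projIcc_coe (s : I) : Set.projIcc (0 : ℝ) 1 zero_le_one s = s := Set.projIcc_val _ s

/-- The hypothesis gives only a null homotopy through free loops. Conjugating the loop at each time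
by the track of its basepoint makes it based; at the end what remains is the track followed by its
inverse, which contracts. -/
theorem eq_zero_of_uncurryLoop_eq {z : Z} {c : PairClass (∅ : Set Y) (Path.refl z)}
    (h : PairClass.pull (ContinuousMap.id _) (Set.empty_subset _) (uncurryLoop c) =
      PairClass.mk (.const (∅ : Set (UnitAddCircle × Y)) z)) : c = 0 := by
  induction c using Quotient.inductionOn with | _ c =>
  obtain ⟨H⟩ := PairClass.exact h
  have H0 : ∀ s y, H (0, s, y) = circleEval (c.1 y) s := fun s y => H.apply_zero (s, y)
  have H1 : ∀ s y, H (1, s, y) = z := fun s y => H.apply_one (s, y)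
  have Hz : ∀ y, H (0, 0, y) = z := fun y =>
    (H0 0 y).trans ((circleEval_coe (c.1 y) 0).trans (c.1 y).source)
  have pi_cont : Continuous (Set.projIcc (0 : ℝ) 1 zero_le_one) := continuous_projIcc
  have ci_cont : Continuous fun r : ℝ =>
      (((Set.projIcc (0 : ℝ) 1 zero_le_one r : I) : ℝ) : UnitAddCircle) :=
    (AddCircle.continuous_mk' 1).comp (continuous_subtype_val.comp pi_cont)
  -- a null homotopy through free loops, conjugated by the trace of the basepoint
  let F : (I × Y) × I → Z := fun q => H (Set.projIcc 0 1 zero_le_one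
    (min (q.1.1 : ℝ) (min (3 * (q.2 : ℝ)) (3 - 3 * (q.2 : ℝ)))),
    ((Set.projIcc (0 : ℝ) 1 zero_le_one (3 * (q.2 : ℝ) - 1) : I) : ℝ), q.1.2)
  have hF : Continuous F := H.continuous.comp ((pi_cont.comp (by fun_prop)).prodMk
    ((ci_cont.comp (by fun_prop)).prodMk (by fun_prop)))
  have hF0 : ∀ p, F (p, 0) = z := by
    rintro ⟨t, y⟩
    change H (Set.projIcc 0 1 zero_le_one
      (min (t : ℝ) (min (3 * (0 : ℝ)) (3 - 3 * (0 : ℝ)))), _, y) = z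
    rw [coe_projIcc_eq_zero (by left; simp), Set.projIcc_of_le_left _ (by simp)]
    exact Hz y
  have hF1 : ∀ p, F (p, 1) = z := by
    rintro ⟨t, y⟩
    change H (Set.projIcc 0 1 zero_le_one
      (min (t : ℝ) (min (3 * (1 : ℝ)) (3 - 3 * (1 : ℝ)))), _, y) = z
    rw [coe_projIcc_eq_zero (by right; norm_num), Set.projIcc_of_le_left _ (by simp)]
    exact Hz y
  -- The track out and back, shrinking to the constant loop as t goes to 1. At t = 0 it agrees with
  -- F at t = 1, since H is constant at its final time and so ignores the circle coordinate on the
  -- middle third.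
  let F' : (I × Y) × I → Z := fun q => H (Set.projIcc 0 1 zero_le_one
    ((1 - (q.1.1 : ℝ)) * (min (1 : ℝ) (min (3 * (q.2 : ℝ)) (3 - 3 * (q.2 : ℝ))))), 0, q.1.2)
  have hF' : Continuous F' := H.continuous.comp ((pi_cont.comp (by fun_prop)).prodMk
    (continuous_const.prodMk (by fun_prop)))
  have hF'0 : ∀ p, F' (p, 0) = z := by
    rintro ⟨t, y⟩
    change H (Set.projIcc 0 1 zero_le_one
        ((1 - (t : ℝ)) * (min (1 : ℝ) (min (3 * (0 : ℝ)) (3 - 3 * (0 : ℝ))))), 0, y) = z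
    rw [Set.projIcc_of_le_left _ (by simp)]
    exact Hz y
  have hF'1 : ∀ p, F' (p, 1) = z := by
    rintro ⟨t, y⟩
    change H (Set.projIcc 0 1 zero_le_one
        ((1 - (t : ℝ)) * (min (1 : ℝ) (min (3 * (1 : ℝ)) (3 - 3 * (1 : ℝ))))), 0, y) = z
    rw [Set.projIcc_of_le_left _ (by simp)]
    exact Hz y
  let K : C(I × Y, Path z z) :=
    ⟨fun p => ⟨⟨fun s => F (p, s), by fun_prop⟩, hF0 p, hF1 p⟩,
      Path.continuous_uncurry_iff.mp hF⟩
  let K' : C(I × Y, Path z z) :=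
    ⟨fun p => ⟨⟨fun s => F' (p, s), by fun_prop⟩, hF'0 p, hF'1 p⟩,
      Path.continuous_uncurry_iff.mp hF'⟩
  let f0 : PairMap (∅ : Set Y) (Path.refl z) :=
    ⟨K.comp ((ContinuousMap.const Y 0).prodMk (ContinuousMap.id Y)), fun _ h => h.elim⟩
  let f1 : PairMap (∅ : Set Y) (Path.refl z) :=
    ⟨K.comp ((ContinuousMap.const Y 1).prodMk (ContinuousMap.id Y)), fun _ h => h.elim⟩
  have e1 : PairClass.mk c = PairClass.mk f0 := by
    refine PairClass.reparam c c f0 (fun q => (1 - (q.1 : ℝ)) * q.2 + q.1 * (3 * q.2 - 1))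
      (by fun_prop) ?_ ?_ ?_ ?_
    · intro t; left
      have := t.2.1
      simpa using this
    · intro t; right
      have := t.2.1
      simp only [Set.Icc.coe_one]
      linarith
    · intro x s
      simp only [Set.Icc.coe_zero, sub_zero, one_mul, zero_mul, add_zero]
      exact Path.extend_apply _ s.2
    · intro x s
      simp only [Set.Icc.coe_one, sub_self, zero_mul, one_mul, zero_add]
      have h3 : (0 : ℝ) ≤ min (3 * (s : ℝ)) (3 - 3 * (s : ℝ)) :=
        le_min (by linarith [s.2.1]) (by linarith [s.2.2])
      have h4 : Set.projIcc (0 : ℝ) 1 zero_le_one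
          (min ((0 : I) : ℝ) (min (3 * (s : ℝ)) (3 - 3 * (s : ℝ)))) = 0 :=
        Set.projIcc_of_le_left _ (min_le_left _ _)
      change _ = H (Set.projIcc (0 : ℝ) 1 zero_le_one
          (min ((0 : I) : ℝ) (min (3 * (s : ℝ)) (3 - 3 * (s : ℝ)))), _, x)
      rw [h4, H0, circleEval_coe]
      rfl
  have e2 : PairClass.mk f0 = PairClass.mk f1 :=
    PairClass.sound K (fun _ => rfl) (fun _ => rfl) (fun _ _ h => h.elim)
  have e3 : PairClass.mk f1 = PairClass.mk (.const (∅ : Set Y) (Path.refl z)) := by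
    refine PairClass.sound K' (fun y => ?_) (fun y => ?_) (fun _ _ h => h.elim)
    · ext s
      change H (Set.projIcc 0 1 zero_le_one
        ((1 - ((0 : I) : ℝ)) * (min (1 : ℝ) (min (3 * (s : ℝ)) (3 - 3 * (s : ℝ))))),
        0, y) = H (Set.projIcc 0 1 zero_le_one
        (min ((1 : I) : ℝ) (min (3 * (s : ℝ)) (3 - 3 * (s : ℝ)))),
        ((Set.projIcc (0 : ℝ) 1 zero_le_one (3 * (s : ℝ) - 1) : I) : ℝ), y)
      simp only [Set.Icc.coe_zero, sub_zero, one_mul, Set.Icc.coe_one]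
      by_cases hs : 3 * (s : ℝ) - 1 ≤ 0 ∨ 1 ≤ 3 * (s : ℝ) - 1
      · rw [coe_projIcc_eq_zero hs]
      · push Not at hs
        have h3 : (1 : ℝ) ≤ min (3 * (s : ℝ)) (3 - 3 * (s : ℝ)) :=
          le_min (by linarith) (by linarith)
        rw [min_eq_left h3, Set.projIcc_right]
        exact (H1 _ y).trans (H1 _ y).symm
    · ext s
      change H (Set.projIcc 0 1 zero_le_one
        ((1 - ((1 : I) : ℝ)) * (min (1 : ℝ) (min (3 * (s : ℝ)) (3 - 3 * (s : ℝ))))),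
        0, y) = z
      rw [Set.projIcc_of_le_left _ (by simp)]
      exact Hz y
  exact e1.trans (e2.trans e3)

theorem mapsTo_zero_section (B : Set Y) :
    Set.MapsTo ((ContinuousMap.const Y 0).prodMk (ContinuousMap.id Y)) B
      ({p | p.1 = 0 ∧ p.2 ∈ B} : Set (UnitAddCircle × Y)) := fun _ hb => ⟨rfl, hb⟩

theorem mapsTo_id_zero_slice (B : Set Y) : Set.MapsTo (ContinuousMap.id (UnitAddCircle × Y))
    {p | p.1 = 0 ∧ p.2 ∈ B} {p | p.1 = 0} := fun _ hp => hp.1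

/-- Homotopy extension for the slice {0} × Y, with an explicit collar: the null homotopy on the
slice extends to a homotopy of the whole map, whose end sends the slice to the basepoint. On B the
null homotopy is constant, so the extension is relative to {0} × B. -/
theorem exists_pull_eq_of_restrict_eq {z : Z} {B : Set Y}
    (x : PairClass ({p | p.1 = 0 ∧ p.2 ∈ B} : Set (UnitAddCircle × Y)) z)
    (h : PairClass.pull ((ContinuousMap.const Y 0).prodMk (ContinuousMap.id Y))
      (mapsTo_zero_section B) x = PairClass.mk (.const B z)) :
    ∃ x' : PairClass ({p | p.1 = 0} : Set (UnitAddCircle × Y)) z,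
      PairClass.pull (ContinuousMap.id _) (mapsTo_id_zero_slice B) x' = x := by
  induction x using Quotient.inductionOn with | _ f =>
  obtain ⟨K⟩ := PairClass.exact h
  have K0 : ∀ y, K (0, y) = f.1 (0, y) := K.apply_zero
  have K1 : ∀ y, K (1, y) = z := K.apply_one
  have KB : ∀ t, ∀ b ∈ B, K (t, b) = z := fun t b hb => K.eq_snd t hb
  -- At time t the collar consists of the points of the cut circle within t/3 of an end. There k is
  -- positive and gives the time at which `K` is evaluated, rising from 0 at the inner edge to t at
  -- the cut.
  let k : I × (I × Y) → ℝ := fun q =>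
    max ((q.2.1 : ℝ) - 3 * q.1) ((q.2.1 : ℝ) - 3 * (1 - q.1))
  -- The map s ↦ (1 + 2t)s - t stretches the rest of the interval. It is the identity at t = 0, and
  -- at the inner edges of the collar it has already left (0, 1), so the circle coordinate is 0
  -- there and the two formulas match.
  let r : I × (I × Y) → ℝ := fun q => q.1 + 2 * q.2.1 * q.1 - q.2.1
  have hk : Continuous k := by fun_prop
  have hr : Continuous r := by fun_prop
  have hr0 : ∀ q, 0 ≤ k q → r q ≤ 0 ∨ 1 ≤ r q := by
    rintro ⟨s, t, y⟩ hq
    have hs := s.2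
    have ht := t.2
    rcases le_max_iff.mp hq with hq | hq
    · left
      change (s : ℝ) + 2 * t * s - t ≤ 0
      nlinarith [hs.1, ht.1, ht.2]
    · right
      change 1 ≤ (s : ℝ) + 2 * t * s - t
      nlinarith [hs.2, ht.1, ht.2]
  have pi_cont : Continuous (Set.projIcc (0 : ℝ) 1 zero_le_one) := continuous_projIcc
  let L : I × (I × Y) → Z := fun q => if k q ≤ 0 then
    f.1 (((Set.projIcc (0 : ℝ) 1 zero_le_one (r q) : I) : ℝ), q.2.2)
    else K (Set.projIcc (0 : ℝ) 1 zero_le_one (k q), q.2.2)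
  have hL : Continuous L := by
    refine Continuous.if_le ?_ ?_ hk continuous_const ?_
    · exact f.1.continuous.comp (((AddCircle.continuous_mk' 1).comp
        (continuous_subtype_val.comp (pi_cont.comp hr))).prodMk (by fun_prop))
    · exact K.continuous.comp ((pi_cont.comp hk).prodMk (by fun_prop))
    · intro q hq
      rw [coe_projIcc_eq_zero (hr0 q hq.ge), hq, Set.projIcc_left]
      exact (K0 _).symm
  have hLk : ∀ q : I × (I × Y), k q = q.2.1 → L q = K q.2 := by
    rintro ⟨s, t, y⟩ hq
    change k (s, t, y) = t at hq
    change (if k (s, t, y) ≤ 0 then _ else _) = _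
    split_ifs with h0
    · have ht : t = 0 := Subtype.ext (le_antisymm (hq.ge.trans h0) t.2.1)
      rw [coe_projIcc_eq_zero (hr0 _ (t.2.1.trans hq.ge)), ht]
      exact (K0 y).symm
    · rw [hq, projIcc_coe]
  have hL0 : ∀ w, L (0, w) = K w := fun w => hLk _ (by
    change max ((w.1 : ℝ) - 3 * (0 : ℝ)) ((w.1 : ℝ) - 3 * (1 - (0 : ℝ))) = w.1
    rw [max_eq_left (by linarith)]; ring)
  have hL1 : ∀ w, L (1, w) = K w := fun w => hLk _ (by
    change max ((w.1 : ℝ) - 3 * (1 : ℝ)) ((w.1 : ℝ) - 3 * (1 - (1 : ℝ))) = w.1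
    rw [max_eq_right (by linarith)]; ring)
  let M : C(UnitAddCircle × (I × Y), Z) :=
    circleGlue ⟨L, hL⟩ fun w => (hL0 w).trans (hL1 w).symm
  have hM : ∀ w, M (0, w) = K w := fun w => (circleGlue_zero _ _ w).trans (hL0 w)
  let f' : PairMap ({p | p.1 = 0} : Set (UnitAddCircle × Y)) z :=
    ⟨⟨fun p => M (p.1, 1, p.2), by fun_prop⟩, by
      rintro ⟨s, y⟩ rfl
      exact (hM _).trans (K1 y)⟩
  refine ⟨PairClass.mk f', Eq.symm ?_⟩
  refine PairClass.sound ⟨fun q => M (q.2.1, q.1, q.2.2), by fun_prop⟩ ?_ (fun _ => rfl) ?_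
  · rintro ⟨s, y⟩
    obtain ⟨s, rfl⟩ := surjective_circle s
    refine (circleGlue_coe ⟨L, hL⟩ (fun w => (hL0 w).trans (hL1 w).symm) s (0, y)).trans ?_
    have h1 : k (s, 0, y) ≤ 0 := by
      change max (((0 : I) : ℝ) - 3 * s) (((0 : I) : ℝ) - 3 * (1 - s)) ≤ 0
      have := s.2.1
      have := s.2.2
      exact max_le (by simp; linarith) (by simp; linarith)
    have h2 : r (s, 0, y) = s := by
      change (s : ℝ) + 2 * ((0 : I) : ℝ) * s - ((0 : I) : ℝ) = s
      simp
    change (if k (s, 0, y) ≤ 0 then _ else _) = _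
    rw [if_pos h1, h2, projIcc_coe]
  · rintro t ⟨s, y⟩ ⟨rfl, hy⟩
    exact (hM _).trans (KB t y hy)

end Circle

/-! ### The split exact sequences -/

section Functoriality

variable {G H K : Type*} [Group G] [TopologicalSpace G] [Group H] [TopologicalSpace H]
  [Group K] [TopologicalSpace K]

theorem B.map_comp (ψ : H →ₜ* K) (φ : G →ₜ* H) :
    (B.map ψ).comp (B.map φ) = B.map (ψ.comp φ) := by
  ext1 y
  obtain ⟨n, t, v, rfl⟩ := B.exists_point y
  rw [ContinuousMap.comp_apply, B.map_point, B.map_point, B.map_point]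
  rfl

theorem B.map_id : B.map (ContinuousMonoidHom.id G) = ContinuousMap.id (B G) := by
  ext1 y
  obtain ⟨n, t, v, rfl⟩ := B.exists_point y
  exact B.map_point _ t v

theorem B.compare_comp_map (φ : G →ₜ* H) : (B.compare H).comp (B.map (zprodMap φ)) =
    ((ContinuousMap.id UnitAddCircle).prodMap (B.map φ)).comp (B.compare G) := by
  ext1 y
  obtain ⟨n, t, v, rfl⟩ := B.exists_point y
  rw [ContinuousMap.comp_apply, B.map_point, compare_point, ContinuousMap.comp_apply,
    compare_point]
  exact Prod.ext rfl (B.map_point φ t _).symm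

theorem B.compare_comp_inr (G : Type*) [Group G] [TopologicalSpace G] [CGGroup G] :
    (B.compare G).comp (B.map (ContinuousMonoidHom.inr (Multiplicative ℤ) G)) =
      (ContinuousMap.const (B G) 0).prodMk (ContinuousMap.id (B G)) := by
  ext1 y
  rw [ContinuousMap.comp_apply, ← B.uncompare_zero]
  exact DFunLike.congr_fun (B.compare_uncompare G) (0, y)

theorem B.uncompare_comp_zero (G : Type*) [Group G] [TopologicalSpace G] [CGGroup G] :
    (B.uncompare G).comp ((ContinuousMap.const (B G) 0).prodMk (ContinuousMap.id (B G))) =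
      B.map (ContinuousMonoidHom.inr (Multiplicative ℤ) G) := by
  ext1 y
  exact B.uncompare_zero G y

end Functoriality

/-! ### Additivity, injectivity and exactness for the pair (B(ℤ × G), A) -/

namespace OmegaSpectrum

variable (E : OmegaSpectrum.{v}) {X X' X'' Y : Type*} [TopologicalSpace X] [TopologicalSpace X']
  [TopologicalSpace X''] [TopologicalSpace Y]

/-- Zero is transported from the constant loop by the homotopy inverse of the structure map, which
preserves basepoints. -/
theorem zero_eq_mk_const (n : ℤ) (A : Set X) :
    (0 : PairClass A (E.pt n)) = PairClass.mk (.const A (E.pt n)) := by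
  refine congrArg PairClass.mk (Subtype.ext (ContinuousMap.ext fun _ => ?_))
  exact (E.equiv rfl).inv_pt

/-- The group structure is defined through the index m + 1, while α̃ uses the structure map along (d
- 1) + 1 = d, which is not a definitional equality. -/
theorem loopEquiv_add_of_eq {m n : ℤ} (h : m + 1 = n) {A : Set X} (a b : PairClass A (E.pt m)) :
    E.loopEquiv h A (a + b) = E.loopEquiv h A a + E.loopEquiv h A b := by
  subst h
  exact E.loopEquiv_add a b

/-- The sum on the target is defined by one more delooping of `E.space n`. After applying that
structure map, both sides live over a double loop space, where `uncurryLoop_loop_add` applies. -/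
theorem uncurryLoop_add {n : ℤ} (a b : PairClass (∅ : Set Y) (Path.refl (E.pt n))) :
    uncurryLoop (a + b) = uncurryLoop a + uncurryLoop b := by
  apply (E.loopEquiv (rfl : n + 1 = n + 1) _).injective
  have h : ∀ c : PairClass (∅ : Set Y) (Path.refl (E.pt n)),
      E.loopEquiv (rfl : n + 1 = n + 1) _ (uncurryLoop c) = uncurryLoop (PairClass.push
        (loopMap (E.equiv rfl).toFun (E.equiv rfl).map_pt) (loopMap_refl _ _) c) :=
    fun c => push_uncurryLoop _ _ c
  rw [loopEquiv_add, h, h, h, PairClass.push_loopMap_add, uncurryLoop_loop_add]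

theorem pull_apply (n : ℤ) {A : Set X} {A' : Set X'} (f : C(X, X')) (hf : Set.MapsTo f A A')
    (c : PairClass A' (E.pt n)) : E.pull n f hf c = PairClass.pull f hf c := rfl

theorem hMap_forget (n : ℤ) {x₀ : X} {x₁ : X'} (f : C(X, X')) (hf : f x₀ = x₁)
    (c : E.hred n x₁) : E.hMap n f (E.forget n x₁ c) = E.forget n x₀ (E.hredMap n f hf c) := by
  induction c using Quotient.inductionOn with | _ c => rfl

theorem pull_comm {X₁ X₂ : Type*} [TopologicalSpace X₁] [TopologicalSpace X₂] (n : ℤ) {A : Set X}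
    {A₁ : Set X₁} {A₂ : Set X₂} {A' : Set X'} {f₁ : C(X, X₁)} {g₁ : C(X₁, X')} {f₂ : C(X, X₂)}
    {g₂ : C(X₂, X')} (hf₁ : Set.MapsTo f₁ A A₁) (hg₁ : Set.MapsTo g₁ A₁ A')
    (hf₂ : Set.MapsTo f₂ A A₂) (hg₂ : Set.MapsTo g₂ A₂ A') (h : g₁.comp f₁ = g₂.comp f₂)
    (c : PairClass A' (E.pt n)) :
    E.pull n f₁ hf₁ (E.pull n g₁ hg₁ c) = E.pull n f₂ hf₂ (E.pull n g₂ hg₂ c) := by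
  simp only [pull_apply]
  rw [PairClass.pull_pull, PairClass.pull_pull]
  exact PairClass.pull_congr _ h c

variable (d : ℤ) (G : Type*) [Group G] [TopologicalSpace G]

/-- The map `α̃`, with values in the cohomology of the pair `(B(ℤ × G), A)`. -/
def alphaPair (A : Set (B (ZProd G))) (hA : Set.MapsTo (B.compare G) A {p | p.1 = 0}) :
    E.h (d - 1) (B G) →+ PairClass A (E.pt d) :=
  AddMonoidHom.mk' (fun c => E.pull d (B.compare G) hA
    (uncurryLoop (E.loopEquiv (sub_add_cancel d 1) ∅ c))) fun a b => by
    rw [loopEquiv_add_of_eq, uncurryLoop_add, map_add]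

theorem alphaPair_apply (A : Set (B (ZProd G))) (hA : Set.MapsTo (B.compare G) A {p | p.1 = 0})
    (c : E.h (d - 1) (B G)) : E.alphaPair d G A hA c = PairClass.pull (B.compare G) hA
      (uncurryLoop (E.loopEquiv (sub_add_cancel d 1) ∅ c)) := rfl

theorem pull_id_alphaPair (A : Set (B (ZProd G)))
    (hA : Set.MapsTo (B.compare G) A {p | p.1 = 0}) (c : E.h (d - 1) (B G)) :
    E.pull d (ContinuousMap.id _) (Set.empty_subset A) (E.alphaPair d G A hA c) =
      E.alphaPair d G ∅ (Set.mapsTo_empty _ _) c := by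
  rw [alphaPair_apply, alphaPair_apply]
  exact PairClass.pull_pull (ContinuousMap.id _) (Set.empty_subset A) (B.compare G) hA _

variable {G} in
theorem alphaPair_natural {H : Type*} [Group H] [TopologicalSpace H] (φ : G →ₜ* H)
    (A : Set (B (ZProd G))) (A' : Set (B (ZProd H)))
    (hA : Set.MapsTo (B.compare G) A {p | p.1 = 0})
    (hA' : Set.MapsTo (B.compare H) A' {p | p.1 = 0})
    (hφ : Set.MapsTo (B.map (zprodMap φ)) A A') (c : E.h (d - 1) (B H)) :
    E.pull d (B.map (zprodMap φ)) hφ (E.alphaPair d H A' hA' c) =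
      E.alphaPair d G A hA (E.hB (d - 1) φ c) := by
  have h : E.loopEquiv (sub_add_cancel d 1) ∅ (E.hB (d - 1) φ c) =
      PairClass.pull (B.map φ) (Set.mapsTo_empty _ _) (E.loopEquiv (sub_add_cancel d 1) ∅ c) :=
    PairClass.push_pull _ _ _ (E.equiv _).map_pt c
  rw [alphaPair_apply, alphaPair_apply, h, ← pull_uncurryLoop, pull_apply, PairClass.pull_pull,
    PairClass.pull_pull]
  exact PairClass.pull_congr _ (B.compare_comp_map φ) _

variable [CGGroup G]

/-- Since the comparison map has a strict right inverse, a class killed by α is already freely null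
homotopic on S¹ × BG. -/
theorem alphaPair_empty_injective :
    Function.Injective (E.alphaPair d G ∅ (Set.mapsTo_empty _ _)) := by
  refine (injective_iff_map_eq_zero _).mpr fun c hc => ?_
  rw [alphaPair_apply, zero_eq_mk_const] at hc
  have h1 : PairClass.pull (ContinuousMap.id _) (Set.empty_subset _)
      (uncurryLoop (E.loopEquiv (sub_add_cancel d 1) ∅ c)) =
      PairClass.mk (.const (∅ : Set (UnitAddCircle × B G)) (E.pt d)) := by
    have h2 := congrArg (PairClass.pull (B.uncompare G) (Set.mapsTo_empty _ _)) hc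
    rw [PairClass.pull_pull, PairClass.pull_congr _ (B.compare_uncompare G)] at h2
    exact h2
  have h3 := eq_zero_of_uncurryLoop_eq h1
  have h4 : E.loopEquiv (sub_add_cancel d 1) (∅ : Set (B G)) 0 = 0 := by
    have := E.loopEquiv_add_of_eq (sub_add_cancel d 1) (A := (∅ : Set (B G))) 0 0
    rw [add_zero] at this
    exact left_eq_add.mp this
  exact (E.loopEquiv (sub_add_cancel d 1) ∅).injective (h3.trans h4.symm)

/-- Forgetting `A` turns the map into the one for the empty set, which is injective. -/
theorem alphaPair_injective (A : Set (B (ZProd G)))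
    (hA : Set.MapsTo (B.compare G) A {p | p.1 = 0}) :
    Function.Injective (E.alphaPair d G A hA) := by
  refine Function.Injective.of_comp (f := E.pull d (ContinuousMap.id _) (Set.empty_subset A)) ?_
  have h : E.pull d (ContinuousMap.id _) (Set.empty_subset A) ∘ E.alphaPair d G A hA =
      E.alphaPair d G ∅ (Set.mapsTo_empty _ _) := funext fun c => E.pull_id_alphaPair d G A hA c
  rw [h]
  exact E.alphaPair_empty_injective d G

/-- A class vanishing on BG is carried to S¹ × BG by the homotopy inverse, where it vanishes on the
slice at 0 and hence comes from a family of loops. The set `C` is the trace of `A` on the slice: the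
basepoint in the reduced case, empty otherwise. -/
theorem exact_alphaPair (A : Set (B (ZProd G))) (C : Set (B G)) (hA₀ : A ⊆ {B.base (ZProd G)})
    (hA : Set.MapsTo (B.compare G) A {p | p.1 = 0})
    (hC : Set.MapsTo (B.compare G) A {p | p.1 = 0 ∧ p.2 ∈ C})
    (hC' : Set.MapsTo (B.uncompare G) {p | p.1 = 0 ∧ p.2 ∈ C} A)
    (hi : Set.MapsTo (B.map (ContinuousMonoidHom.inr (Multiplicative ℤ) G)) C A) :
    Function.Exact (E.alphaPair d G A hA)
      (E.pull d (B.map (ContinuousMonoidHom.inr (Multiplicative ℤ) G)) hi) := by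
  intro x
  constructor
  · intro hx
    rw [pull_apply, zero_eq_mk_const] at hx
    have h1 : PairClass.pull ((ContinuousMap.const (B G) 0).prodMk (ContinuousMap.id (B G)))
        (mapsTo_zero_section C)
        (PairClass.pull (B.uncompare G) hC' x) = PairClass.mk (.const C (E.pt d)) := by
      rw [PairClass.pull_pull, PairClass.pull_congr _ (B.uncompare_comp_zero G)]
      exact hx
    obtain ⟨x', hx'⟩ := exists_pull_eq_of_restrict_eq _ h1
    obtain ⟨c, rfl⟩ := surjective_uncurryLoop _ x'
    refine ⟨(E.loopEquiv (sub_add_cancel d 1) ∅).symm c, ?_⟩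
    rw [alphaPair_apply, Equiv.apply_symm_apply]
    have h2 := congrArg (PairClass.pull (B.compare G) hC) hx'
    rw [PairClass.pull_pull, PairClass.pull_pull] at h2
    refine h2.trans (PairClass.pull_of_homotopic_id _ ?_ x)
    obtain ⟨K⟩ := B.uncompare_compare G
    -- The homotopy is relative to the basepoint, hence to any subset of it; this covers both
    -- choices of `A`.
    exact ⟨{ K with prop' := fun t a ha => K.prop' t a (hA₀ ha) }⟩
  · rintro ⟨c, rfl⟩
    rw [alphaPair_apply, zero_eq_mk_const, pull_apply, PairClass.pull_pull,
      PairClass.pull_congr _ (B.compare_comp_inr G)]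
    induction (E.loopEquiv (sub_add_cancel d 1) ∅ c) using Quotient.inductionOn with | _ c =>
    exact congrArg PairClass.mk (Subtype.ext (ContinuousMap.ext fun y =>
      (circleEval_coe (c.1 y) 0).trans (c.1 y).source))

theorem exact_alphaRed : Function.Exact (E.alphaPair d G {B.base (ZProd G)}
    (by rintro _ rfl; exact B.compare_base G)) (E.betaRed d G) := by
  have h : B.compare G (B.base (ZProd G)) = (0, B.base G) := by
    rw [← B.uncompare_base]
    exact DFunLike.congr_fun (B.compare_uncompare G) _
  refine E.exact_alphaPair d G _ {B.base G} subset_rfl _ ?_ ?_ ?_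
  · rintro _ rfl
    rw [h]
    exact ⟨rfl, rfl⟩
  · rintro ⟨_, _⟩ ⟨rfl, rfl⟩
    exact B.uncompare_base G

theorem exact_alpha : Function.Exact (E.alphaPair d G ∅ (Set.mapsTo_empty _ _)) (E.beta d G) :=
  E.exact_alphaPair d G ∅ ∅ (Set.empty_subset _) _ (Set.mapsTo_empty _ _)
    (fun _ h => h.2) (Set.mapsTo_empty _ _)

omit [CGGroup G]

theorem pull_inr_pull_snd (A : Set (B G)) (A' : Set (B (ZProd G)))
    (h₁ : Set.MapsTo (B.map (ContinuousMonoidHom.inr (Multiplicative ℤ) G)) A A')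
    (h₂ : Set.MapsTo (B.map (ContinuousMonoidHom.snd (Multiplicative ℤ) G)) A' A)
    (c : PairClass A (E.pt d)) : E.pull d _ h₁ (E.pull d _ h₂ c) = c := by
  have h : (B.map (ContinuousMonoidHom.snd (Multiplicative ℤ) G)).comp
      (B.map (ContinuousMonoidHom.inr (Multiplicative ℤ) G)) = ContinuousMap.id (B G) := by
    rw [B.map_comp, ← B.map_id]
    rfl
  rw [pull_apply, pull_apply, PairClass.pull_pull, PairClass.pull_congr _ h]
  exact PairClass.pull_of_homotopic_id _ (.refl _) c

end OmegaSpectrum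

/-! ### Direct sum decompositions from split short exact sequences -/

section Split

variable {L M N : Type*} [AddCommGroup L] [AddCommGroup M] [AddCommGroup N]

/-- The direct sum decomposition given by a split short exact sequence. -/
def splitEquiv (α : L →+ M) (β : M →+ N) (s : N →+ M) (hα : Function.Injective α)
    (hαβ : Function.Exact α β) (hs : ∀ y, β (s y) = y) : M ≃+ L × N :=
  (AddEquiv.ofBijective (α.coprod s) (by
    constructor
    · refine (injective_iff_map_eq_zero _).mpr ?_
      rintro ⟨a, b⟩ h
      rw [AddMonoidHom.coprod_apply] at h
      have hb : b = 0 := by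
        have := congrArg β h
        rwa [map_add, hαβ.apply_apply_eq_zero, zero_add, hs, map_zero] at this
      subst hb
      rw [map_zero, add_zero] at h
      exact Prod.ext (hα (h.trans (map_zero α).symm)) rfl
    · intro x
      obtain ⟨a, ha⟩ := (hαβ (x - s (β x))).mp (by rw [map_sub, hs, sub_self])
      exact ⟨(a, β x), by rw [AddMonoidHom.coprod_apply, ha, sub_add_cancel]⟩)).symm

variable {α : L →+ M} {β : M →+ N} {s : N →+ M} (hα : Function.Injective α)
  (hαβ : Function.Exact α β) (hs : ∀ y, β (s y) = y)

theorem splitEquiv_symm_apply (a : L) (b : N) :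
    (splitEquiv α β s hα hαβ hs).symm (a, b) = α a + s b := rfl

theorem splitEquiv_snd (x : M) : (splitEquiv α β s hα hαβ hs x).2 = β x := by
  obtain ⟨⟨a, b⟩, rfl⟩ := (splitEquiv α β s hα hαβ hs).symm.surjective x
  rw [AddEquiv.apply_symm_apply, splitEquiv_symm_apply, map_add, hαβ.apply_apply_eq_zero,
    zero_add, hs]

theorem splitEquiv_natural {L' M' N' : Type*} [AddCommGroup L'] [AddCommGroup M'] [AddCommGroup N']
    {α' : L' →+ M'} {β' : M' →+ N'} {s' : N' →+ M'} (hα' : Function.Injective α')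
    (hαβ' : Function.Exact α' β') (hs' : ∀ y, β' (s' y) = y) (l : L →+ L') (m : M →+ M')
    (n : N →+ N') (hl : ∀ a, m (α a) = α' (l a)) (hn : ∀ b, m (s b) = s' (n b)) (x : M) :
    splitEquiv α' β' s' hα' hαβ' hs' (m x) =
      (l (splitEquiv α β s hα hαβ hs x).1, n (splitEquiv α β s hα hαβ hs x).2) := by
  obtain ⟨⟨a, b⟩, rfl⟩ := (splitEquiv α β s hα hαβ hs).symm.surjective x
  rw [AddEquiv.apply_symm_apply, ← AddEquiv.eq_symm_apply, splitEquiv_symm_apply,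
    splitEquiv_symm_apply, map_add, hl, hn]

end Split

end GenCoh

end

/-! ### The decomposition theorem -/

theorem mainTheorem1 (E : GenCoh.OmegaSpectrum.{v}) (d : ℤ) :
    ∃ (αr : ∀ (G : Type u) [Group G] [TopologicalSpace G] [GenCoh.CGGroup G],
        E.h (d - 1) (GenCoh.B G) →+ E.hred d (GenCoh.B.base (GenCoh.ZProd G)))
      (α : ∀ (G : Type u) [Group G] [TopologicalSpace G] [GenCoh.CGGroup G],
        E.h (d - 1) (GenCoh.B G) →+ E.h d (GenCoh.B (GenCoh.ZProd G)))
      (Φr : ∀ (G : Type u) [Group G] [TopologicalSpace G] [GenCoh.CGGroup G],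
        E.hred d (GenCoh.B.base (GenCoh.ZProd G)) ≃+
          E.h (d - 1) (GenCoh.B G) × E.hred d (GenCoh.B.base G))
      (Φ : ∀ (G : Type u) [Group G] [TopologicalSpace G] [GenCoh.CGGroup G],
        E.h d (GenCoh.B (GenCoh.ZProd G)) ≃+ E.h (d - 1) (GenCoh.B G) × E.h d (GenCoh.B G)),
      (∀ (G : Type u) [Group G] [TopologicalSpace G] [GenCoh.CGGroup G],
        -- the map `α̃` is the prescribed composition
        (∀ c, αr G c = E.alphaRed d G c) ∧
        -- the first square commutes, and `α` is the only map with this property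
        (∀ f : E.h (d - 1) (GenCoh.B G) → E.h d (GenCoh.B (GenCoh.ZProd G)),
          (∀ c, f c = E.forget d (GenCoh.B.base (GenCoh.ZProd G)) (αr G c)) ↔ f = α G) ∧
        -- the second square commutes
        (∀ x, E.beta d G (E.forget d (GenCoh.B.base (GenCoh.ZProd G)) x) =
          E.forget d (GenCoh.B.base G) (E.betaRed d G x)) ∧
        -- the first row is a split short exact sequence
        Function.Injective (αr G) ∧
        Function.Exact (αr G) (E.betaRed d G) ∧
        Function.Surjective (E.betaRed d G) ∧
        (∀ y, E.betaRed d G (E.sigmaRed d G y) = y) ∧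
        -- the second row is a split short exact sequence
        Function.Injective (α G) ∧
        Function.Exact (α G) (E.beta d G) ∧
        Function.Surjective (E.beta d G) ∧
        (∀ y, E.beta d G (E.sigma d G y) = y) ∧
        -- the splittings are compatible with the vertical maps
        (∀ y, E.sigma d G (E.forget d (GenCoh.B.base G) y) =
          E.forget d (GenCoh.B.base (GenCoh.ZProd G)) (E.sigmaRed d G y)) ∧
        -- the direct sum decompositions are those given by the split exact rows
        (∀ a b, (Φr G).symm (a, b) = αr G a + E.sigmaRed d G b) ∧
        (∀ x, (Φr G x).2 = E.betaRed d G x) ∧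
        (∀ a b, (Φ G).symm (a, b) = α G a + E.sigma d G b) ∧
        (∀ x, (Φ G x).2 = E.beta d G x)) ∧
      -- naturality in the group
      (∀ (G H : Type u) [Group G] [TopologicalSpace G] [GenCoh.CGGroup G]
        [Group H] [TopologicalSpace H] [GenCoh.CGGroup H] (φ : G →ₜ* H),
        (∀ c, E.hredB d (GenCoh.zprodMap φ) (αr H c) = αr G (E.hB (d - 1) φ c)) ∧
        (∀ c, E.hB d (GenCoh.zprodMap φ) (α H c) = α G (E.hB (d - 1) φ c)) ∧
        (∀ x, E.hredB d φ (E.betaRed d H x) = E.betaRed d G (E.hredB d (GenCoh.zprodMap φ) x)) ∧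
        (∀ x, E.hB d φ (E.beta d H x) = E.beta d G (E.hB d (GenCoh.zprodMap φ) x)) ∧
        (∀ y, E.hredB d (GenCoh.zprodMap φ) (E.sigmaRed d H y) =
          E.sigmaRed d G (E.hredB d φ y)) ∧
        (∀ y, E.hB d (GenCoh.zprodMap φ) (E.sigma d H y) = E.sigma d G (E.hB d φ y)) ∧
        (∀ x, E.hB d (GenCoh.zprodMap φ) (E.forget d (GenCoh.B.base (GenCoh.ZProd H)) x) =
          E.forget d (GenCoh.B.base (GenCoh.ZProd G)) (E.hredB d (GenCoh.zprodMap φ) x)) ∧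
        (∀ y, E.hB d φ (E.forget d (GenCoh.B.base H) y) =
          E.forget d (GenCoh.B.base G) (E.hredB d φ y)) ∧
        (∀ x, Φr G (E.hredB d (GenCoh.zprodMap φ) x) =
          (E.hB (d - 1) φ (Φr H x).1, E.hredB d φ (Φr H x).2)) ∧
        (∀ x, Φ G (E.hB d (GenCoh.zprodMap φ) x) =
          (E.hB (d - 1) φ (Φ H x).1, E.hB d φ (Φ H x).2))) := by
  have hbase : ∀ (G : Type u) [Group G] [TopologicalSpace G],
      Set.MapsTo (GenCoh.B.compare G) {GenCoh.B.base (GenCoh.ZProd G)} {p | p.1 = 0} := by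
    rintro G _ _ _ rfl
    exact GenCoh.B.compare_base G
  have hsr : ∀ (G : Type u) [Group G] [TopologicalSpace G],
      ∀ y, E.betaRed d G (E.sigmaRed d G y) = y := fun G _ _ y => E.pull_inr_pull_snd d G _ _ _ _ y
  have hs : ∀ (G : Type u) [Group G] [TopologicalSpace G],
      ∀ y, E.beta d G (E.sigma d G y) = y := fun G _ _ y => E.pull_inr_pull_snd d G _ _ _ _ y
  have hsnd : ∀ (G H : Type u) [Group G] [TopologicalSpace G] [Group H] [TopologicalSpace H]
      (φ : G →ₜ* H), (GenCoh.B.map (ContinuousMonoidHom.snd (Multiplicative ℤ) H)).comp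
        (GenCoh.B.map (GenCoh.zprodMap φ)) =
      (GenCoh.B.map φ).comp (GenCoh.B.map (ContinuousMonoidHom.snd (Multiplicative ℤ) G)) := by
    intro G H _ _ _ _ φ
    rw [GenCoh.B.map_comp, GenCoh.B.map_comp]
    rfl
  have hinr : ∀ (G H : Type u) [Group G] [TopologicalSpace G] [Group H] [TopologicalSpace H]
      (φ : G →ₜ* H), (GenCoh.B.map (ContinuousMonoidHom.inr (Multiplicative ℤ) H)).comp
        (GenCoh.B.map φ) = (GenCoh.B.map (GenCoh.zprodMap φ)).comp
          (GenCoh.B.map (ContinuousMonoidHom.inr (Multiplicative ℤ) G)) := by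
    intro G H _ _ _ _ φ
    rw [GenCoh.B.map_comp, GenCoh.B.map_comp]
    rfl
  -- Both rows use the same map of pairs, relative to the basepoint and relative to the empty set;
  -- the isomorphisms are the splittings of the resulting exact rows.
  refine ⟨fun G _ _ _ => E.alphaPair d G {GenCoh.B.base (GenCoh.ZProd G)} (hbase G),
    fun G _ _ _ => E.alphaPair d G ∅ (Set.mapsTo_empty _ _),
    fun G _ _ _ => GenCoh.splitEquiv _ _ _ (E.alphaPair_injective d G _ (hbase G))
      (E.exact_alphaRed d G) (hsr G),
    fun G _ _ _ => GenCoh.splitEquiv _ _ _ (E.alphaPair_injective d G _ (Set.mapsTo_empty _ _))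
      (E.exact_alpha d G) (hs G), ?_, ?_⟩
  · intro G _ _ _
    refine ⟨fun _ => rfl, fun f => ?_, fun x => ?_, E.alphaPair_injective d G _ (hbase G),
      E.exact_alphaRed d G, fun y => ⟨_, hsr G y⟩, hsr G,
      E.alphaPair_injective d G _ (Set.mapsTo_empty _ _), E.exact_alpha d G,
      fun y => ⟨_, hs G y⟩, hs G, fun y => ?_, fun _ _ => rfl, fun x => ?_, fun _ _ => rfl,
      fun x => ?_⟩
    · simp only [GenCoh.OmegaSpectrum.forget, E.pull_id_alphaPair d G _ (hbase G)]
      exact funext_iff.symm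
    · exact E.hMap_forget d _ (GenCoh.B.map_base _) x
    · exact E.hMap_forget d _ (GenCoh.B.map_base _) y
    · exact GenCoh.splitEquiv_snd _ _ _ x
    · exact GenCoh.splitEquiv_snd _ _ _ x
  · intro G H _ _ _ _ _ _ φ
    have har := E.alphaPair_natural d φ _ _ (hbase G) (hbase H)
      (by rintro _ rfl; exact GenCoh.B.map_base _)
    have ha := E.alphaPair_natural d φ ∅ ∅ (Set.mapsTo_empty _ _) (Set.mapsTo_empty _ _)
      (Set.mapsTo_empty _ _)
    have hσr : ∀ y, E.hredB d (GenCoh.zprodMap φ) (E.sigmaRed d H y) =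
        E.sigmaRed d G (E.hredB d φ y) := fun y => E.pull_comm d _ _ _ _ (hsnd G H φ) y
    have hσ : ∀ y, E.hB d (GenCoh.zprodMap φ) (E.sigma d H y) =
        E.sigma d G (E.hB d φ y) := fun y => E.pull_comm d _ _ _ _ (hsnd G H φ) y
    exact ⟨har, ha, fun x => (E.pull_comm d _ _ _ _ (hinr G H φ) x),
      fun x => (E.pull_comm d _ _ _ _ (hinr G H φ) x), hσr, hσ,
      fun x => E.hMap_forget d _ (GenCoh.B.map_base _) x,
      fun x => E.hMap_forget d _ (GenCoh.B.map_base _) x,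
      GenCoh.splitEquiv_natural _ _ _ _ _ _ (E.hB (d - 1) φ) _ _ har hσr,
      GenCoh.splitEquiv_natural _ _ _ _ _ _ (E.hB (d - 1) φ) _ _ ha hσ⟩
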